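/- Let $G$ be a group generated by a finite set $\Gamma$, and suppose $G$ is infinitary: for all $\alpha,\beta,\gamma\in G$ with $\alpha\beta\gamma\neq\beta$ the set $\{\alpha^n\beta\gamma^n\mid n\in\mathbb{N}\}$ is infinite. Write $\mathrm{delay}(\alpha,\beta)=\alpha^{-1}\beta$, let $d(\alpha,\beta)$ be the distance in the undirected right Cayley graph of $(G,\Gamma)$, and for words $u,v$ let $\mathrm{dist}(u,v)=|u|+|v|-2|\mathrm{lcp}(u,v)|$, where $\mathrm{lcp}$ is the longest common prefix. A weighted automaton over a finite alphabet $A$ is a tuple $W=(Q,t_{\mathrm{init}},t_{\mathrm{final}},T)$ with $Q$ a finite set and $t_{\mathrm{init}},t_{\mathrm{final}}\subseteq Q\times G$, $T\subseteq Q\times A\times G\times Q$ finite. The output of a run is the product of the weights of its transitions; $p\xrightarrow{w\mid\beta}q$ means that there is a run from $p$ to $q$ on $w$ with output $\beta$. The relation computed by $W$ is $[\![W]\!]=\{(w,\alpha\beta\gamma)\mid (p,\alpha)\in t_{\mathrm{init}},\ p\xrightarrow{w\mid\beta}q,\ (q,\gamma)\in t_{\mathrm{final}}\}\subseteq A^*\times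 G$. $W$ is trimmed if every state occurs in some accepting run. $W$ is sequential if $|t_{\mathrm{init}}|=1$ and for all $p\in Q$, $a\in A$ there is at most one transition of the form $(p,a,\alpha,q)$ in $T$. $W$ is $k$-sequential if it is a union (on disjoint state sets) of $k$ sequential weighted automata. Let $W$ be a trimmed weighted automaton over $G$ and let $k\geq 1$. The following are equivalent. (i) $[\![W]\!]$ satisfies the Lipschitz property of order $k$: there is $L\in\mathbb{N}$ such that for all $(w_0,\alpha_0),\dots,(w_k,\alpha_k)\in[\![W]\!]$ there are $0\leq i<j\leq k$ with $d(\alpha_i,\alpha_j)\leq L\,(\mathrm{dist}(w_i,w_j)+1)$. (ii) $W$ satisfies the branching twinning property of order $k$: for all states $q_{i,j}$ ($0\leq i,j\leq k$), all $\gamma_j$ with $(q_{0,j},\gamma_j)\in t_{\mathrm{init}}$, and all words $u_{i,j},v_{i,j}$ and runs $q_{i-1,j}\xrightarrow{u_{i,j}\mid\alpha_{i,j}}q_{i,j}$, $q_{i,j}\xrightarrow{v_{i,j}\mid\beta_{i,j}}q_{i,j}$ ($1\leq i\leq k$, $0\leq j\leq k$), there are $j\neq j'$ such that for all $i\in\{1,\dots,k\}$: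 if $u_{i',j}=u_{i',j'}$ and $v_{i',j}=v_{i',j'}$ for all $1\leq i'\leq i$, then $$\mathrm{delay}(\gamma_j\alpha_{1,j}\cdots\alpha_{i,j},\ \gamma_{j'}\alpha_{1,j'}\cdots\alpha_{i,j'})=\mathrm{delay}(\gamma_j\alpha_{1,j}\cdots\alpha_{i,j}\beta_{i,j},\ \gamma_{j'}\alpha_{1,j'}\cdots\alpha_{i,j'}\beta_{i,j'}).$$ (iii) $[\![W]\!]$ is computed by a $k$-sequential weighted automaton. Moreover, the $k$-sequential automaton can be computed effectively: representing elements of $G$ by words over $\Gamma\cup\Gamma^{-1}$, there is one algorithm, using the word problem of $(G,\Gamma)$ as an oracle, that on input the size of the alphabet, $k$ and a trimmed weighted automaton $W$ satisfying the above conditions outputs $k$ sequential weighted automata whose union computes $[\![W]\!]$. (In particular this is an ordinary algorithm if $G$ has a decidable word problem.) -/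

import Mathlib

/-- A group is infinitary if `{αⁿ β γⁿ | n ∈ ℕ}` is infinite whenever `α β γ ≠ β`. -/
def IsInfinitary (G : Type*) [Group G] : Prop :=
  ∀ α β γ : G, α * β * γ ≠ β → {x : G | ∃ n : ℕ, x = α ^ n * β * γ ^ n}.Infinite

/-- The delay `α⁻¹ β` between two group elements. -/
def delay {G : Type*} [Group G] (α β : G) : G := α⁻¹ * β

/-- The Cayley distance: the length of a shortest path in the undirected right Cayley graph of
`G` with respect to `Γ`.  It is only used when `Γ` generates `G`, so that the graph is
connected. -/
noncomputable def cayleyDist {G : Type*} [Group G] (Γ : Set G) (α β : G) : ℕ :=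
  (SimpleGraph.mulCayley Γ).dist α β

open Classical in
/-- The longest common prefix of two words. -/
noncomputable def lcp {A : Type*} : List A → List A → List A
  | a :: u, b :: v => if a = b then a :: lcp u v else []
  | _, _ => []

/-- The distance `|u| + |v| - 2 |lcp u v|` between two words (the subtraction never truncates,
since the longest common prefix is at most as long as each of the words). -/
noncomputable def wordDist {A : Type*} (u v : List A) : ℕ :=
  u.length + v.length - 2 * (lcp u v).length

/-- The Lipschitz property of order `k` of a relation between words and group elements, with
respect to the set `Γ` of generators. -/
def LipschitzOfOrder {A G : Type*} [Group G] (Γ : Set G) (k : ℕ) (R : Set (List A × G)) : Prop :=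
  ∃ L : ℕ, ∀ x : Fin (k + 1) → List A × G, (∀ i, x i ∈ R) →
    ∃ i j, i < j ∧
      cayleyDist Γ (x i).2 (x j).2 ≤ L * (wordDist (x i).1 (x j).1 + 1)

/-- A weighted automaton with input alphabet `A`, set of states `Q` and weights in `M`, with
initial and final relations.  (`A` and `Q` are finite wherever this is used.) -/
structure WeightedAutomaton (A Q M : Type*) where
  init : Set (Q × M)
  final : Set (Q × M)
  trans : Set (Q × A × M × Q)
  init_finite : init.Finite
  final_finite : final.Finite
  trans_finite : trans.Finite

namespace WeightedAutomaton

/-- `W.Run p w α q`: there is a run of `W` from `p` to `q` on the word `w` with output `α`. -/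
inductive Run {A Q M : Type*} [Monoid M] (W : WeightedAutomaton A Q M) :
    Q → List A → M → Q → Prop
  | nil (p : Q) : Run W p [] 1 p
  | cons {p q r : Q} {a : A} {w : List A} {α β : M} :
      (p, a, α, q) ∈ W.trans → Run W q w β r → Run W p (a :: w) (α * β) r

/-- The relation computed by a weighted automaton (set semantics). -/
def rel {A Q M : Type*} [Monoid M] (W : WeightedAutomaton A Q M) : Set (List A × M) :=
  {x | ∃ p q α β γ, (p, α) ∈ W.init ∧ W.Run p x.1 β q ∧ (q, γ) ∈ W.final ∧ x.2 = α * β * γ}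

/-- Every state appears in some accepting run. -/
def IsTrim {A Q M : Type*} [Monoid M] (W : WeightedAutomaton A Q M) : Prop :=
  ∀ q, ∃ p r u v α β γ δ,
    (p, α) ∈ W.init ∧ W.Run p u β q ∧ W.Run q v γ r ∧ (r, δ) ∈ W.final

/-- Exactly one initial pair, and at most one transition from each state on each letter. -/
def IsSequential {A Q M : Type*} (W : WeightedAutomaton A Q M) : Prop :=
  (∃ x, W.init = {x}) ∧
    ∀ p a α q α' q', (p, a, α, q) ∈ W.trans → (p, a, α', q') ∈ W.trans → α = α' ∧ q = q'

/-- The union of finitely many weighted automata, on the disjoint union of their state sets. -/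
def union {A M : Type*} {k : ℕ} {Q : Fin k → Type*} (V : ∀ i, WeightedAutomaton A (Q i) M) :
    WeightedAutomaton A (Σ i, Q i) M where
  init := ⋃ i, (fun x : Q i × M => (⟨i, x.1⟩, x.2)) '' (V i).init
  final := ⋃ i, (fun x : Q i × M => (⟨i, x.1⟩, x.2)) '' (V i).final
  trans := ⋃ i, (fun t : Q i × A × M × Q i => (⟨i, t.1⟩, t.2.1, t.2.2.1, ⟨i, t.2.2.2⟩)) ''
    (V i).trans
  init_finite := Set.finite_iUnion fun i => (V i).init_finite.image _
  final_finite := Set.finite_iUnion fun i => (V i).final_finite.image _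
  trans_finite := Set.finite_iUnion fun i => (V i).trans_finite.image _

/-- The branching twinning property of order `k`.  The runs are indexed by `j : Fin (k + 1)`.
The `i`-th step (`i : Fin k`) of run `j` leads from `q i.castSucc j` to `q i.succ j` reading
`u i j` with output `α i j`, and is followed by the loop around `q i.succ j` reading `v i j` with
output `β i j`.  The product of the outputs `α` of the steps up to and including step `i` is
`Fin.partialProd (fun i' => α i' j) i.succ`. -/
def BTP {A Q G : Type*} [Group G] (W : WeightedAutomaton A Q G) (k : ℕ) : Prop :=
  ∀ (q : Fin (k + 1) → Fin (k + 1) → Q) (γ : Fin (k + 1) → G)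
    (u v : Fin k → Fin (k + 1) → List A) (α β : Fin k → Fin (k + 1) → G),
    (∀ j, (q 0 j, γ j) ∈ W.init) →
    (∀ i j, W.Run (q i.castSucc j) (u i j) (α i j) (q i.succ j)) →
    (∀ i j, W.Run (q i.succ j) (v i j) (β i j) (q i.succ j)) →
    ∃ j j', j ≠ j' ∧ ∀ i : Fin k, (∀ i' ≤ i, u i' j = u i' j' ∧ v i' j = v i' j') →
      delay (γ j * Fin.partialProd (fun i' => α i' j) i.succ)
          (γ j' * Fin.partialProd (fun i' => α i' j') i.succ) =
        delay (γ j * Fin.partialProd (fun i' => α i' j) i.succ * β i j)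
          (γ j' * Fin.partialProd (fun i' => α i' j') i.succ * β i j')

end WeightedAutomaton

/-- A relation is `k`-sequential if it is computed by a union of `k` sequential weighted automata
with finitely many states. -/
def IsKSequential {A M : Type*} [Monoid M] (k : ℕ) (R : Set (List A × M)) : Prop :=
  ∃ (Q : Fin k → Type) (V : ∀ i, WeightedAutomaton A (Q i) M),
    (∀ i, Finite (Q i)) ∧ (∀ i, (V i).IsSequential) ∧ (WeightedAutomaton.union V).rel = R

/-- Words over `r` generators and their formal inverses: `(i, true)` stands for the `i`-th
generator and `(i, false)` for its inverse. -/
abbrev GenWord (r : ℕ) : Type := List (Fin r × Bool)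

/-- The group element represented by a word over the generators `s` and their inverses. -/
def evalGenWord {G : Type*} [Group G] {r : ℕ} (s : Fin r → G) (w : GenWord r) : G :=
  FreeGroup.lift s (FreeGroup.mk w)

open Classical in
/-- The word problem of `G` with respect to the generators `s`, as an oracle: the characteristic
function of the set of codes of the words that represent the neutral element. -/
noncomputable def wordProblem {G : Type*} [Group G] {r : ℕ} (s : Fin r → G) : ℕ →. ℕ :=
  fun n => Part.some
    (if ∃ w : GenWord r, Encodable.encode w = n ∧ evalGenWord s w = 1 then 1 else 0)

/-- Finite descriptions of weighted automata: the number of states, the initial pairs, the final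
pairs and the transitions.  States and letters are numbers, weights are words over the
generators. -/
abbrev AutomatonCode (r : ℕ) : Type :=
  ℕ × List (ℕ × GenWord r) × List (ℕ × GenWord r) × List (ℕ × ℕ × GenWord r × ℕ)

/-- The weighted automaton over the alphabet `{0, …, m - 1}` described by a code; entries that
mention states or letters out of range are ignored. -/
def AutomatonCode.toAutomaton {G : Type*} [Group G] {r : ℕ} (s : Fin r → G) (m : ℕ)
    (c : AutomatonCode r) : WeightedAutomaton (Fin m) (Fin c.1) G where
  init := {x | ∃ w, ((x.1 : ℕ), w) ∈ c.2.1 ∧ x.2 = evalGenWord s w}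
  final := {x | ∃ w, ((x.1 : ℕ), w) ∈ c.2.2.1 ∧ x.2 = evalGenWord s w}
  trans := {t | ∃ w, ((t.1 : ℕ), (t.2.1 : ℕ), w, (t.2.2.2 : ℕ)) ∈ c.2.2.2 ∧
    t.2.2.1 = evalGenWord s w}
  init_finite := by
    refine Set.Finite.subset (Set.finite_univ.prod
      ((c.2.1.finite_toSet).image fun y => evalGenWord s y.2)) ?_
    rintro ⟨q, g⟩ ⟨w, hw, hg⟩
    exact ⟨trivial, _, hw, hg.symm⟩
  final_finite := by
    refine Set.Finite.subset (Set.finite_univ.prod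
      ((c.2.2.1.finite_toSet).image fun y => evalGenWord s y.2)) ?_
    rintro ⟨q, g⟩ ⟨w, hw, hg⟩
    exact ⟨trivial, _, hw, hg.symm⟩
  trans_finite := by
    refine Set.Finite.subset (Set.finite_univ.prod (Set.finite_univ.prod
      (((c.2.2.2.finite_toSet).image fun y => evalGenWord s y.2.2.1).prod
        Set.finite_univ))) ?_
    rintro ⟨p, a, g, q⟩ ⟨w, hw, hg⟩
    exact ⟨trivial, trivial, ⟨_, hw, hg.symm⟩, trivial⟩

/-!
The branching twinning property is restated in terms of traces. A trace is a run that is cut into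
steps, at the end of each of which a loop is inspected but not taken; it records the words read and,
for each loop, the conjugate `g β g⁻¹` of the output `β` of the loop by the output `g` produced
before it. Two loops preserve the delay `g⁻¹ g'` if and only if these conjugates coincide. So two
traces violate the twinning condition if they differ in such a conjugate at a step up to which they
read the same words; they are then called separated. The property of order `k` says that no `k + 1`
traces from the initial configurations are pairwise separated (`btp_iff`). The number of steps does
not matter: steps that do not help to separate the traces can be merged, after which fewer steps
than traces are left (`Trace.exists_short`).

The Lipschitz property implies the branching twinning property: given `k + 1` pairwise separated
traces, complete their runs to accepting runs, from the last step to the first, and iterate the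
loops of each step often enough to move apart the outputs of those traces that the step separates
(`Trace.exists_far`). This works as, in an infinitary group, the elements `c⁻ⁿ dⁿ` are pairwise
distinct whenever `c ≠ d`, and as balls are finite. Conversely, among `k + 1` pairs in a relation
computed by `k` sequential automata, two come from the same automaton, whose runs agree on the common
prefix of the two words.

The main part is the construction of `k` sequential automata from the branching twinning property.
Let the degree of a set of configurations (states with the output so far) be the largest number of
pairwise separated traces starting there. Among configurations reached on a common word from a set
`R`, two that are further apart than a bound depending on `R` can be separated by loops on that word,
simultaneously for any bounded number of runs: otherwise their delay would be determined by the
tuple of states of the runs, and could take only few values (`JointRun.exists_trace`). Consequently,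
a set of configurations reached from `R` is either of bounded diameter or falls into two nonempty
parts that are far apart (`exists_split`), and in the second case the degrees of the parts add up to
at most the degree of `R` (`Admissible.succs`). So a subset construction that follows sets of
configurations up to translation, and distributes its copies among the two parts whenever a set
splits, has finitely many states; starting it with `k` copies of the initial set gives `k` sequential
automata (`exists_sequential_of_subsets`, `BTP.exists_sequential`).

For the effectiveness, the construction need not be executed. It also provides finite simulations
between the given automaton and the union of the sequential ones, and these only rely on finitely
many equations in the group. The algorithm searches for codes of sequential automata together with
such simulations and a list of equations. Checking a candidate is primitive recursive, apart from the
equations, which are verified with the oracle (`exists_recursiveIn_search`). The search succeeds by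
the construction, and every result is correct, as simulations imply inclusions of the computed
relations.
-/

/-! ### Word length in the Cayley graph -/

section CayleyLength

variable {G : Type*} [Group G] {Γ : Set G}

/-- The word length of a group element with respect to `Γ`: its Cayley distance to the neutral
element. -/
noncomputable def cayleyLength (Γ : Set G) (g : G) : ℕ := cayleyDist Γ 1 g

theorem SimpleGraph.mulCayley_preconnected (hΓ : Subgroup.closure Γ = ⊤) :
    (SimpleGraph.mulCayley Γ).Preconnected := by
  have step : ∀ (a g : G), g ∈ Γ → (SimpleGraph.mulCayley Γ).Reachable a (a * g) := by
    intro a g hg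
    by_cases h : a = a * g
    · rw [← h]
    · exact SimpleGraph.Adj.reachable
        ((SimpleGraph.mulCayley_adj' Γ _ _).2 ⟨h, g, hg, Or.inl rfl⟩)
  have key : ∀ g ∈ Subgroup.closure Γ, ∀ a, (SimpleGraph.mulCayley Γ).Reachable a (a * g) := by
    intro g hg
    induction hg using Subgroup.closure_induction with
    | mem x hx => exact fun a => step a x hx
    | one => intro a; simp
    | mul x y _ _ hx hy => intro a; rw [← mul_assoc]; exact (hx a).trans (hy _)
    | inv x _ hx => intro a; simpa using (hx (a * x⁻¹)).symm
  intro a b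
  simpa using key (a⁻¹ * b) (by simp [hΓ]) a

theorem cayleyDist_mul_left (c a b : G) : cayleyDist Γ (c * a) (c * b) = cayleyDist Γ a b := by
  have key : ∀ c a b : G, (SimpleGraph.mulCayley Γ).Reachable a b →
      cayleyDist Γ (c * a) (c * b) ≤ cayleyDist Γ a b := by
    intro c a b h
    obtain ⟨p, hp⟩ := h.exists_walk_length_eq_dist
    let φ : SimpleGraph.mulCayley Γ →g SimpleGraph.mulCayley Γ :=
      ⟨fun x => c * x, fun {x y} h => SimpleGraph.mulCayley_adj_mul_iff_right.2 h⟩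
    have := SimpleGraph.dist_le (p.map φ)
    rw [SimpleGraph.Walk.length_map, hp] at this
    exact this
  by_cases h : (SimpleGraph.mulCayley Γ).Reachable a b
  · refine le_antisymm (key c a b h) ?_
    let φ : SimpleGraph.mulCayley Γ →g SimpleGraph.mulCayley Γ :=
      ⟨fun x => c * x, fun {x y} h => SimpleGraph.mulCayley_adj_mul_iff_right.2 h⟩
    simpa using key c⁻¹ (c * a) (c * b) (h.map φ)
  · have h' : ¬ (SimpleGraph.mulCayley Γ).Reachable (c * a) (c * b) := by
      intro h'
      let φ : SimpleGraph.mulCayley Γ →g SimpleGraph.mulCayley Γ :=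
        ⟨fun x => c⁻¹ * x, fun {x y} h => SimpleGraph.mulCayley_adj_mul_iff_right.2 h⟩
      exact h (by simpa [φ] using h'.map φ)
    unfold cayleyDist
    rw [SimpleGraph.dist_eq_zero_of_not_reachable h, SimpleGraph.dist_eq_zero_of_not_reachable h']

theorem cayleyDist_eq (a b : G) : cayleyDist Γ a b = cayleyLength Γ (a⁻¹ * b) := by
  have h := cayleyDist_mul_left (Γ := Γ) a⁻¹ a b
  rw [inv_mul_cancel] at h
  exact h.symm

theorem cayleyLength_one : cayleyLength Γ 1 = 0 := SimpleGraph.dist_self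

theorem cayleyLength_inv (a : G) : cayleyLength Γ a⁻¹ = cayleyLength Γ a := by
  rw [cayleyLength, ← cayleyDist_mul_left a, cayleyLength, cayleyDist, cayleyDist,
    SimpleGraph.dist_comm]
  simp

theorem cayleyLength_mul (hΓ : Subgroup.closure Γ = ⊤) (a b : G) :
    cayleyLength Γ (a * b) ≤ cayleyLength Γ a + cayleyLength Γ b := by
  have h : cayleyDist Γ a (a * b) = cayleyLength Γ b := by rw [cayleyDist_eq]; simp
  rw [← h]
  exact SimpleGraph.Connected.dist_triangle ⟨SimpleGraph.mulCayley_preconnected hΓ⟩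

theorem finite_cayleyLength_le (hΓ : Subgroup.closure Γ = ⊤) (hf : Γ.Finite) (n : ℕ) :
    {g : G | cayleyLength Γ g ≤ n}.Finite := by
  have nbr : ∀ a, {b | (SimpleGraph.mulCayley Γ).Adj a b}.Finite := by
    intro a
    refine ((hf.image fun g => a * g).union (hf.image fun g => a * g⁻¹)).subset ?_
    intro b hb
    obtain ⟨-, g, hg, rfl | rfl⟩ := (SimpleGraph.mulCayley_adj' Γ _ _).1 hb
    · exact Or.inl ⟨g, hg, rfl⟩
    · exact Or.inr ⟨g, hg, by simp⟩
  have key : ∀ n a, {b | ∃ p : (SimpleGraph.mulCayley Γ).Walk a b, p.length = n}.Finite := by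
    intro n
    induction n with
    | zero =>
      refine fun a => (Set.finite_singleton a).subset ?_
      rintro b ⟨p, hp⟩
      exact (SimpleGraph.Walk.eq_of_length_eq_zero hp).symm
    | succ n ih =>
      intro a
      refine ((nbr a).biUnion fun c _ => ih c).subset ?_
      rintro b ⟨p, hp⟩
      cases p with
      | nil => simp at hp
      | cons h p => exact Set.mem_biUnion h ⟨p, by simpa using hp⟩
  refine ((Set.finite_Iic n).biUnion fun i _ => key i 1).subset ?_
  intro g hg
  obtain ⟨p, hp⟩ := (SimpleGraph.mulCayley_preconnected hΓ 1 g).exists_walk_length_eq_dist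
  exact Set.mem_biUnion (show cayleyLength Γ g ∈ Set.Iic n from hg) ⟨p, hp⟩

theorem exists_cayleyLength_le_of_finite {S : Set G} (hS : S.Finite) :
    ∃ C, ∀ g ∈ S, cayleyLength Γ g ≤ C := by
  obtain ⟨C, hC⟩ := (hS.image (cayleyLength Γ)).bddAbove
  exact ⟨C, fun g hg => hC ⟨g, hg, rfl⟩⟩

end CayleyLength

/-! ### Traces and separation -/

section Separation

variable {A Q G : Type*} [Group G] {W : WeightedAutomaton A Q G}

namespace WeightedAutomaton

theorem Run.append {M : Type*} [Monoid M] {W : WeightedAutomaton A Q M} {p q r : Q}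
    {u v : List A} {α β : M} (h : W.Run p u α q) (h' : W.Run q v β r) :
    W.Run p (u ++ v) (α * β) r := by
  induction h with
  | nil p => simpa using h'
  | cons ht _ ih => rw [mul_assoc]; exact .cons ht (ih h')

theorem Run.flatten_replicate {M : Type*} [Monoid M] {W : WeightedAutomaton A Q M} {p : Q}
    {u : List A} {α : M} (h : W.Run p u α p) (n : ℕ) :
    W.Run p (List.replicate n u).flatten (α ^ n) p := by
  induction n with
  | zero => simpa using Run.nil p
  | succ n ih => rw [List.replicate_succ, List.flatten_cons, pow_succ']; exact h.append ih

/-- `W.Trace x l y`: starting in the configuration `x` (a state together with the output so far),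
`W` reaches the configuration `y` along a sequence of steps, each of which consists of a run
followed by a loop that is inspected but not taken.  The list `l` records for each step the word
`u` of the run, the word `v` of the loop and the conjugate `g β g⁻¹` of the output `β` of the
loop by the output `g` produced before the loop. -/
inductive Trace (W : WeightedAutomaton A Q G) :
    Q × G → List (List A × List A × G) → Q × G → Prop
  | nil (x : Q × G) : Trace W x [] x
  | cons {p q : Q} {g α β : G} {u v : List A} {l : List (List A × List A × G)} {y : Q × G} :
      W.Run p u α q → W.Run q v β q → Trace W (q, g * α) l y →
      Trace W (p, g) ((u, v, g * α * β * (g * α)⁻¹) :: l) y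

theorem Trace.append {x y z : Q × G} {l l' : List (List A × List A × G)}
    (h : W.Trace x l y) (h' : W.Trace y l' z) : W.Trace x (l ++ l') z := by
  induction h with
  | nil x => simpa using h'
  | cons hu hv _ ih => exact .cons hu hv (ih h')

theorem Trace.single {p q : Q} {α : G} {u : List A} (h : W.Run p u α q) (g : G) :
    W.Trace (p, g) [(u, [], 1)] (q, g * α) := by
  have := Trace.cons (g := g) h (.nil q) (.nil (q, g * α))
  simpa using this

theorem Trace.loop {p : Q} {β : G} {v : List A} (h : W.Run p v β p) (g : G) :
    W.Trace (p, g) [([], v, g * β * g⁻¹)] (p, g) := by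
  have := Trace.cons (g := g) (.nil p) h (.nil (p, g * 1))
  simpa using this

theorem Trace.mul_left {x y : Q × G} {l : List (List A × List A × G)} (h : W.Trace x l y) (a : G) :
    W.Trace (x.1, a * x.2) (l.map fun s => (s.1, s.2.1, a * s.2.2 * a⁻¹)) (y.1, a * y.2) := by
  induction h with
  | nil x => exact .nil _
  | @cons p q g α β u v l y hu hv _ ih =>
    have := Trace.cons (g := a * g) hu hv (by simpa [mul_assoc] using ih)
    simpa [mul_assoc] using this

end WeightedAutomaton

end Separation

section Separated

variable {A G : Type*}

/-- Two traces are separated if at some step, up to which they read the same words, the conjugated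
outputs of the loops differ.  (The outputs of two loops taken after the outputs `g` and `g'` leave
the delay `g⁻¹ g'` unchanged if and only if their conjugates by `g` and `g'` are equal.) -/
def Separated : List (List A × List A × G) → List (List A × List A × G) → Prop
  | (u, v, c) :: l, (u', v', c') :: l' => u = u' ∧ v = v' ∧ (c ≠ c' ∨ Separated l l')
  | _, _ => False

/-- The words read by a trace. -/
def traceInput (l : List (List A × List A × G)) : List (List A × List A) :=
  l.map fun s => (s.1, s.2.1)

theorem Separated.append_right : ∀ {l l' : List (List A × List A × G)} (m m'),
    Separated l l' → Separated (l ++ m) (l' ++ m')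
  | (_, _, _) :: _, (_, _, _) :: _, m, m', ⟨hu, hv, h⟩ =>
    ⟨hu, hv, h.imp id (Separated.append_right m m')⟩
  | [], _, _, _, h => by simp [Separated] at h
  | _ :: _, [], _, _, h => by simp [Separated] at h

theorem Separated.append_left : ∀ {l l' m m' : List (List A × List A × G)},
    traceInput l = traceInput l' → Separated m m' → Separated (l ++ m) (l' ++ m')
  | (_, _, _) :: _, (_, _, _) :: _, m, m', h, hm => by
    simp only [traceInput, List.map_cons, List.cons.injEq, Prod.mk.injEq] at h
    exact ⟨h.1.1, h.1.2, Or.inr (Separated.append_left h.2 hm)⟩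
  | [], [], _, _, _, h => h
  | [], _ :: _, _, _, h, _ => by simp [traceInput] at h
  | _ :: _, [], _, _, h, _ => by simp [traceInput] at h

theorem separated_of_ne : ∀ {l l' : List (List A × List A × G)},
    traceInput l = traceInput l' → l ≠ l' → Separated l l'
  | (_, _, c) :: l, (_, _, c') :: l', h, hm => by
    simp only [traceInput, List.map_cons, List.cons.injEq, Prod.mk.injEq] at h
    refine ⟨h.1.1, h.1.2, ?_⟩
    by_cases hc : c = c'
    · refine Or.inr (separated_of_ne h.2 fun hl => hm ?_)
      rw [h.1.1, h.1.2, hc, hl]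
    · exact Or.inl hc
  | [], [], _, h => by simp at h
  | [], _ :: _, h, _ => by simp [traceInput] at h
  | _ :: _, [], h, _ => by simp [traceInput] at h

theorem Separated.conj [Group G] : ∀ {l l' : List (List A × List A × G)} (a : G), Separated l l' →
    Separated (l.map fun s => (s.1, s.2.1, a * s.2.2 * a⁻¹))
      (l'.map fun s => (s.1, s.2.1, a * s.2.2 * a⁻¹))
  | (_, _, _) :: _, (_, _, _) :: _, a, ⟨hu, hv, h⟩ =>
    ⟨hu, hv, h.imp (fun h h' => h (by simpa using h')) (Separated.conj a)⟩
  | [], _, _, h => by simp [Separated] at h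
  | _ :: _, [], _, h => by simp [Separated] at h

theorem separated_ofFn {k : ℕ} {f f' : Fin k → List A × List A × G} :
    Separated (List.ofFn f) (List.ofFn f') ↔
      ∃ i, (∀ i' ≤ i, (f i').1 = (f' i').1 ∧ (f i').2.1 = (f' i').2.1) ∧
        (f i).2.2 ≠ (f' i).2.2 := by
  induction k with
  | zero => simp [Separated]
  | succ k ih =>
    rw [List.ofFn_succ, List.ofFn_succ]
    have : ∀ (x y : List A × List A × G) l l', Separated (x :: l) (y :: l') ↔
        x.1 = y.1 ∧ x.2.1 = y.2.1 ∧ (x.2.2 ≠ y.2.2 ∨ Separated l l') := fun _ _ _ _ => Iff.rfl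
    rw [this, ih]
    constructor
    · rintro ⟨h1, h2, h | ⟨i, hi, h⟩⟩
      · refine ⟨0, fun i' hi' => ?_, h⟩
        obtain rfl : i' = 0 := by simpa using hi'
        exact ⟨h1, h2⟩
      · refine ⟨i.succ, fun i' hi' => ?_, h⟩
        induction i' using Fin.cases with
        | zero => exact ⟨h1, h2⟩
        | succ i' => exact hi i' (by simpa using hi')
    · rintro ⟨i, hi, h⟩
      obtain ⟨h1, h2⟩ := hi 0 (Fin.zero_le _)
      refine ⟨h1, h2, ?_⟩
      induction i using Fin.cases with
      | zero => exact Or.inl h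
      | succ i => exact Or.inr ⟨i, fun i' hi' => hi i'.succ (by simpa using hi'), h⟩

/-- Prolong the run of the first step of a trace by a word to its left. -/
def prependRun (u : List A) :
    List (List A × List A × G) → List (List A × List A × G)
  | [] => []
  | (u', v, c) :: l => (u ++ u', v, c) :: l

theorem length_prependRun (u : List A) (l : List (List A × List A × G)) :
    (prependRun u l).length = l.length := by
  cases l <;> rfl

theorem Separated.prependRun : ∀ {l l' : List (List A × List A × G)} (u : List A),
    Separated l l' → Separated (prependRun u l) (prependRun u l')
  | (_, _, _) :: _, (_, _, _) :: _, u, ⟨hu, hv, h⟩ => ⟨by rw [hu], hv, h⟩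
  | [], _, _, h => by simp [Separated] at h
  | _ :: _, [], _, h => by simp [Separated] at h

/-- Pairwise separated traces read the same words in their first step. -/
theorem exists_common_head {ι : Type*} (J : Finset ι) (l : ι → List (List A × List A × G))
    (hJ : 1 < J.card) (hs : ∀ i ∈ J, ∀ j ∈ J, i ≠ j → Separated (l i) (l j)) :
    ∃ u v, ∀ j ∈ J, ∃ c t, l j = (u, v, c) :: t := by
  obtain ⟨i₀, hi₀, i₁, hi₁, h01⟩ := Finset.one_lt_card.1 hJ
  have h := hs i₀ hi₀ i₁ hi₁ h01
  match hli : l i₀ with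
  | [] => rw [hli] at h; simp [Separated] at h
  | (u, v, c) :: t =>
    refine ⟨u, v, fun j hj => ?_⟩
    by_cases hj0 : j = i₀
    · subst hj0; exact ⟨c, t, hli⟩
    have h := hs i₀ hi₀ j hj (Ne.symm hj0)
    rw [hli] at h
    match hlj : l j with
    | [] => rw [hlj] at h; simp [Separated] at h
    | (u', v', c') :: t' =>
      rw [hlj] at h
      obtain ⟨rfl, rfl, -⟩ := h
      exact ⟨c', t', rfl⟩

end Separated

section Separation

variable {A Q G : Type*} [Group G] {W : WeightedAutomaton A Q G}

namespace WeightedAutomaton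

theorem Trace.prependRun {p q : Q} {g α : G} {u : List A} {l : List (List A × List A × G)}
    {y : Q × G} (hu : W.Run p u α q) (h : W.Trace (q, g * α) l y) :
    ∃ y', W.Trace (p, g) (prependRun u l) y' := by
  cases h with
  | nil => exact ⟨_, .nil _⟩
  | @cons _ q' _ α' β u' v l y hu' hv hl =>
    refine ⟨y, ?_⟩
    rw [mul_assoc g α α']
    exact .cons (hu.append hu') hv (by rwa [← mul_assoc])

theorem Trace.pad {x y : Q × G} {l : List (List A × List A × G)} (h : W.Trace x l y) (n : ℕ) :
    W.Trace x (l ++ List.replicate n ([], [], 1)) y := by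
  refine h.append ?_
  induction n with
  | zero => exact .nil _
  | succ n ih =>
    have := Trace.cons (g := y.2) (.nil y.1) (.nil y.1) (by simpa using ih)
    simpa [List.replicate_succ] using this

theorem Trace.exists_of_cons {x z : Q × G} {s : List A × List A × G}
    {l : List (List A × List A × G)} (h : W.Trace x (s :: l) z) :
    ∃ q α β, W.Run x.1 s.1 α q ∧ W.Run q s.2.1 β q ∧
      s.2.2 = x.2 * α * β * (x.2 * α)⁻¹ ∧ W.Trace (q, x.2 * α) l z := by
  cases h with
  | cons hu hv hl => exact ⟨_, _, _, hu, hv, rfl, hl⟩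

/-- Pairwise separated traces can be shortened so that their length is less than their number:
steps whose loops do not split any class of equally labelled traces are merged into the next
step. -/
theorem Trace.exists_short {ι : Type*} (N : ℕ) (J : Finset ι) (x y : ι → Q × G)
    (l : ι → List (List A × List A × G)) (hN : ∀ j ∈ J, (l j).length ≤ N)
    (hl : ∀ j ∈ J, W.Trace (x j) (l j) (y j))
    (hs : ∀ i ∈ J, ∀ j ∈ J, i ≠ j → Separated (l i) (l j)) :
    ∃ l' : ι → List (List A × List A × G),
      (∀ j ∈ J, (l' j).length + 1 ≤ max 1 J.card ∧ ∃ y', W.Trace (x j) (l' j) y') ∧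
      ∀ i ∈ J, ∀ j ∈ J, i ≠ j → Separated (l' i) (l' j) := by
  classical
  induction N generalizing J x y l with
  | zero =>
    refine ⟨l, fun j hj => ⟨?_, y j, hl j hj⟩, hs⟩
    have := hN j hj
    omega
  | succ N ih =>
    by_cases hJ : J.card ≤ 1
    · refine ⟨fun _ => [], fun j hj => ⟨by simp, x j, .nil _⟩, fun i hi j hj hij => ?_⟩
      exact absurd (Finset.card_le_one.1 hJ i hi j hj) hij
    push Not at hJ
    obtain ⟨i₀, hi₀, i₁, hi₁, h01⟩ := Finset.one_lt_card.1 hJ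
    obtain ⟨u, v, hd⟩ := exists_common_head J l hJ hs
    choose! c t ht using hd
    have htr : ∀ j ∈ J, ∃ q α β, W.Run (x j).1 u α q ∧ W.Run q v β q ∧
        c j = (x j).2 * α * β * ((x j).2 * α)⁻¹ ∧ W.Trace (q, (x j).2 * α) (t j) (y j) := by
      intro j hj
      have := hl j hj
      rw [ht j hj] at this
      exact this.exists_of_cons
    have : Nonempty Q := ⟨(x i₀).1⟩
    choose! q α β hu hv hc htr using htr
    have hlen : ∀ j ∈ J, (t j).length ≤ N := by
      intro j hj
      have := hN j hj
      rw [ht j hj] at this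
      simpa using this
    have hst : ∀ i ∈ J, ∀ j ∈ J, i ≠ j → c i ≠ c j ∨ Separated (t i) (t j) := by
      intro i hi j hj hij
      have := hs i hi j hj hij
      rw [ht i hi, ht j hj] at this
      exact this.2.2
    have hcls : ∀ d, ∃ l' : ι → List (List A × List A × G),
        (∀ j ∈ J.filter (c · = d), (l' j).length + 1 ≤ max 1 (J.filter (c · = d)).card ∧
          ∃ y', W.Trace (q j, (x j).2 * α j) (l' j) y') ∧
        ∀ i ∈ J.filter (c · = d), ∀ j ∈ J.filter (c · = d), i ≠ j →
          Separated (l' i) (l' j) := by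
      intro d
      refine ih _ (fun j => (q j, (x j).2 * α j)) y t
        (fun j hj => hlen j (Finset.mem_filter.1 hj).1)
        (fun j hj => htr j (Finset.mem_filter.1 hj).1) ?_
      intro i hi j hj hij
      rw [Finset.mem_filter] at hi hj
      exact (hst i hi.1 j hj.1 hij).resolve_left fun h => h (hi.2.trans hj.2.symm)
    choose l' hl' hs' using hcls
    by_cases hconst : ∀ j ∈ J, c j = c i₀
    · have hJf : J.filter (c · = c i₀) = J := Finset.filter_true_of_mem hconst
      have hl'' := hl' (c i₀)
      have hs'' := hs' (c i₀)
      rw [hJf] at hl'' hs''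
      refine ⟨fun j => _root_.prependRun u (l' (c i₀) j), fun j hj => ?_,
        fun i hi j hj hij => (hs'' i hi j hj hij).prependRun u⟩
      obtain ⟨h1, y', h2⟩ := hl'' j hj
      exact ⟨by rwa [length_prependRun], Trace.prependRun (hu j hj) h2⟩
    · push Not at hconst
      obtain ⟨j₁, hj₁, hne⟩ := hconst
      have hlt : ∀ d, (J.filter (c · = d)).card < J.card := by
        intro d
        refine Finset.card_lt_card (Finset.filter_ssubset.2 ?_)
        by_cases h : c i₀ = d
        · exact ⟨j₁, hj₁, fun h' => hne (h'.trans h.symm)⟩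
        · exact ⟨i₀, hi₀, h⟩
      refine ⟨fun j => (u, v, c j) :: l' (c j) j, fun j hj => ?_, fun i hi j hj hij => ?_⟩
      · obtain ⟨h1, y', h2⟩ := hl' (c j) j (Finset.mem_filter.2 ⟨hj, rfl⟩)
        refine ⟨?_, y', ?_⟩
        · have := hlt (c j)
          rw [List.length_cons]
          omega
        · have := Trace.cons (hu j hj) (hv j hj) h2
          rwa [← hc j hj] at this
      · refine ⟨rfl, rfl, ?_⟩
        by_cases h : c i = c j
        · right
          simp only [← h]
          exact hs' (c i) i (Finset.mem_filter.2 ⟨hi, rfl⟩) j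
            (Finset.mem_filter.2 ⟨hj, h.symm⟩) hij
        · exact Or.inl h

theorem partialProd_succ_zero {k : ℕ} (α : Fin (k + 1) → G) :
    Fin.partialProd α (Fin.succ 0) = α 0 := by
  rw [Fin.partialProd_succ', Fin.partialProd_zero, mul_one]

theorem Trace.exists_fun {k : ℕ} {p : Q} {g : G} {l : List (List A × List A × G)} {y : Q × G}
    (h : W.Trace (p, g) l y) (hk : l.length = k) :
    ∃ (q : Fin (k + 1) → Q) (u v : Fin k → List A) (α β : Fin k → G), q 0 = p ∧
      (∀ i, W.Run (q i.castSucc) (u i) (α i) (q i.succ)) ∧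
      (∀ i, W.Run (q i.succ) (v i) (β i) (q i.succ)) ∧
      l = List.ofFn fun i => (u i, v i, g * Fin.partialProd α i.succ * β i *
        (g * Fin.partialProd α i.succ)⁻¹) := by
  induction k generalizing p g l with
  | zero =>
    obtain rfl := List.length_eq_zero_iff.1 hk
    exact ⟨fun _ => p, Fin.elim0, Fin.elim0, Fin.elim0, Fin.elim0, rfl, fun i => i.elim0,
      fun i => i.elim0, by simp⟩
  | succ k ih =>
    cases h with
    | nil => simp at hk
    | @cons _ q₁ _ α₁ β₁ u₁ v₁ l y hu hv hl =>
      obtain ⟨q, u, v, α, β, hq, h1, h2, hl'⟩ := ih hl (by simpa using hk)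
      refine ⟨Fin.cons p q, Fin.cons u₁ u, Fin.cons v₁ v, Fin.cons α₁ α, Fin.cons β₁ β, rfl,
        fun i => ?_, fun i => ?_, ?_⟩
      · induction i using Fin.cases with
        | zero => simpa [hq] using hu
        | succ i => simpa using h1 i
      · induction i using Fin.cases with
        | zero => simpa [hq] using hv
        | succ i => simpa using h2 i
      · rw [List.ofFn_succ, hl', partialProd_succ_zero]
        simp [Fin.partialProd_succ', mul_assoc]

theorem trace_ofFn {k : ℕ} (q : Fin (k + 1) → Q) (g : G) (u v : Fin k → List A)
    (α β : Fin k → G) (h1 : ∀ i, W.Run (q i.castSucc) (u i) (α i) (q i.succ))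
    (h2 : ∀ i, W.Run (q i.succ) (v i) (β i) (q i.succ)) :
    ∃ y, W.Trace (q 0, g) (List.ofFn fun i => (u i, v i, g * Fin.partialProd α i.succ * β i *
        (g * Fin.partialProd α i.succ)⁻¹)) y := by
  induction k generalizing g with
  | zero => exact ⟨_, .nil _⟩
  | succ k ih =>
    obtain ⟨y, hy⟩ := ih (fun i => q i.succ) (g * α 0) (fun i => u i.succ) (fun i => v i.succ)
      (fun i => α i.succ) (fun i => β i.succ) (fun i => h1 i.succ) (fun i => h2 i.succ)
    refine ⟨y, ?_⟩
    rw [List.ofFn_succ, partialProd_succ_zero]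
    have := Trace.cons (h1 0) (h2 0) hy
    simpa [Fin.partialProd_succ', Fin.tail_def, mul_assoc] using this

/-- `W.HasSeparated S J`: there is a family, indexed by `J`, of pairwise separated traces that
start in configurations from `S`. -/
def HasSeparated (W : WeightedAutomaton A Q G) (S : Set (Q × G)) (J : Type*) : Prop :=
  ∃ (x y : J → Q × G) (l : J → List (List A × List A × G)), (∀ j, x j ∈ S) ∧
    (∀ j, W.Trace (x j) (l j) (y j)) ∧ Pairwise fun i j => Separated (l i) (l j)

theorem delay_eq_iff (a b β β' : G) :
    delay a b = delay (a * β) (b * β') ↔ a * β * a⁻¹ = b * β' * b⁻¹ := by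
  unfold delay
  constructor
  · intro h
    have h' : a * β * a⁻¹ * b = b * β' := by
      calc a * β * a⁻¹ * b = a * β * (a⁻¹ * b) := by group
        _ = b * β' := by rw [h]; group
    rw [← h']; group
  · intro h
    have h' : β' = b⁻¹ * (a * β * a⁻¹) * b := by rw [h]; group
    rw [h']; group

/-- The branching twinning property of order `k` says that no `k + 1` traces from the initial
configurations are pairwise separated. -/
theorem btp_iff (k : ℕ) : W.BTP k ↔ ¬ W.HasSeparated W.init (Fin (k + 1)) := by
  constructor
  · rintro h ⟨x, y, l, hx, hl, hs⟩
    obtain ⟨l₁, hl₁, hs₁⟩ := Trace.exists_short _ Finset.univ x y l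
      (fun j hj => Finset.le_sup (f := fun j => (l j).length) hj) (fun j _ => hl j)
      (fun i _ j _ hij => hs hij)
    have key : ∀ j, ∃ (q : Fin (k + 1) → Q) (u v : Fin k → List A) (α β : Fin k → G),
        q 0 = (x j).1 ∧
        (∀ i, W.Run (q i.castSucc) (u i) (α i) (q i.succ)) ∧
        (∀ i, W.Run (q i.succ) (v i) (β i) (q i.succ)) ∧
        l₁ j ++ List.replicate (k - (l₁ j).length) ([], [], 1) =
          List.ofFn fun i => (u i, v i, (x j).2 * Fin.partialProd α i.succ * β i *
          ((x j).2 * Fin.partialProd α i.succ)⁻¹) := by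
      intro j
      obtain ⟨h1, y', h2⟩ := hl₁ j (Finset.mem_univ j)
      rw [Finset.card_univ, Fintype.card_fin] at h1
      refine (h2.pad (k - (l₁ j).length)).exists_fun ?_
      rw [List.length_append, List.length_replicate]
      omega
    choose q u v α β hq h1 h2 heq using key
    obtain ⟨j, j', hne, hj⟩ := h (fun i j => q j i) (fun j => (x j).2) (fun i j => u j i)
      (fun i j => v j i) (fun i j => α j i) (fun i j => β j i)
      (fun j => by simpa [hq] using hx j) (fun i j => h1 j i) (fun i j => h2 j i)
    have hsep := (hs₁ j (Finset.mem_univ _) j' (Finset.mem_univ _) hne).append_right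
      (List.replicate (k - (l₁ j).length) ([], [], 1))
      (List.replicate (k - (l₁ j').length) ([], [], 1))
    rw [heq, heq, separated_ofFn] at hsep
    obtain ⟨i, hi, hne'⟩ := hsep
    exact hne' ((delay_eq_iff _ _ _ _).1 (hj i hi))
  · intro h q γ u v α β hγ h1 h2
    by_contra! hcon
    have key : ∀ j, ∃ y, W.Trace (q 0 j, γ j) (List.ofFn fun i => (u i j, v i j,
        γ j * Fin.partialProd (fun i' => α i' j) i.succ * β i j *
        (γ j * Fin.partialProd (fun i' => α i' j) i.succ)⁻¹)) y := fun j =>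
      trace_ofFn (fun i => q i j) (γ j) (fun i => u i j) (fun i => v i j) (fun i => α i j)
        (fun i => β i j) (fun i => h1 i j) (fun i => h2 i j)
    choose y hy using key
    refine h ⟨fun j => (q 0 j, γ j), y, _, hγ, hy, fun j j' hne => ?_⟩
    obtain ⟨i, hi, hne'⟩ := hcon j j' hne
    exact separated_ofFn.2 ⟨i, hi, fun h => hne' ((delay_eq_iff _ _ _ _).2 h)⟩

theorem HasSeparated.mono {S S' : Set (Q × G)} {J : Type*} (h : W.HasSeparated S J)
    (hS : S ⊆ S') : W.HasSeparated S' J := by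
  obtain ⟨x, y, l, hx, hl, hs⟩ := h
  exact ⟨x, y, l, fun j => hS (hx j), hl, hs⟩

theorem HasSeparated.of_injective {S : Set (Q × G)} {J J' : Type*} (h : W.HasSeparated S J)
    {f : J' → J} (hf : f.Injective) : W.HasSeparated S J' := by
  obtain ⟨x, y, l, hx, hl, hs⟩ := h
  exact ⟨x ∘ f, y ∘ f, l ∘ f, fun j => hx _, fun j => hl _, fun i j hij => hs (hf.ne hij)⟩

end WeightedAutomaton

end Separation

/-! ### From the Lipschitz property to the branching twinning property -/

section Pumping

theorem wordDist_append_left {A : Type*} (w u v : List A) :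
    wordDist (w ++ u) (w ++ v) = wordDist u v := by
  induction w with
  | nil => rfl
  | cons a w ih =>
    rw [← ih]
    simp only [wordDist, List.cons_append, lcp, if_pos, List.length_cons]
    omega

/-- In an infinitary group, the elements `c⁻ⁿ dⁿ` are pairwise distinct if `c ≠ d`: if two of them
were equal, the sequence would be eventually periodic, and so take only finitely many values. -/
theorem IsInfinitary.injective_inv_pow_mul_pow {G : Type*} [Group G] (hG : IsInfinitary G) {c d : G}
    (h : c ≠ d) : Function.Injective fun n : ℕ => (c ^ n)⁻¹ * d ^ n := by
  have hinf := hG c⁻¹ 1 d (by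
    rw [mul_one]
    intro h'
    exact h (inv_mul_eq_one.1 h'))
  set f : ℕ → G := fun n => (c ^ n)⁻¹ * d ^ n with hf
  have hadd : ∀ n i, f (n + i) = (c ^ i)⁻¹ * f n * d ^ i := by
    intro n i
    simp only [hf, pow_add, mul_inv_rev, mul_assoc]
  have key : ∀ m n, m < n → f m ≠ f n := by
    refine fun m n hmn heq => hinf ?_
    refine ((Set.finite_Iio n).image f).subset ?_
    rintro _ ⟨k, rfl⟩
    have : c⁻¹ ^ k * 1 * d ^ k = f k := by simp [hf]
    rw [this]
    clear this
    induction k using Nat.strong_induction_on with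
    | _ k ih =>
      by_cases hk : k < n
      · exact ⟨k, hk, rfl⟩
      · have h1 : f k = f (k - (n - m)) := by
          have e1 : k = n + (k - n) := by omega
          have e2 : k - (n - m) = m + (k - n) := by omega
          rw [e2, hadd, heq, ← hadd, ← e1]
        rw [h1]
        exact ih _ (by omega)
  intro m n hmn
  by_contra hne
  rcases lt_or_gt_of_ne hne with h | h
  · exact key _ _ h hmn
  · exact key _ _ h hmn.symm

namespace WeightedAutomaton

variable {A Q G : Type*} [Group G] {W : WeightedAutomaton A Q G} {Γ : Set G}

/-- Pumping the loops of pairwise separated traces yields accepted words whose outputs violate any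
given Lipschitz bound. The loops of the first step are iterated often enough, after the remainders
of the words have been fixed; this moves apart the traces whose first loops differ, and leaves the
distances between the other traces unchanged. -/
theorem Trace.exists_far (hG : IsInfinitary G) (hΓ : Subgroup.closure Γ = ⊤) (hf : Γ.Finite)
    (hW : W.IsTrim) (L : ℕ) {ι : Type*} (N : ℕ) (J : Finset ι) (x y : ι → Q × G)
    (l : ι → List (List A × List A × G)) (hN : ∀ j ∈ J, (l j).length ≤ N)
    (hl : ∀ j ∈ J, W.Trace (x j) (l j) (y j))
    (hs : ∀ i ∈ J, ∀ j ∈ J, i ≠ j → Separated (l i) (l j)) :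
    ∃ (w : ι → List A) (o : ι → G),
      (∀ j ∈ J, ∃ β q γ, W.Run (x j).1 (w j) β q ∧ (q, γ) ∈ W.final ∧
        o j = (x j).2 * β * γ) ∧
      ∀ i ∈ J, ∀ j ∈ J, i ≠ j →
        L * (wordDist (w i) (w j) + 1) < cayleyLength Γ ((o i)⁻¹ * o j) := by
  classical
  induction N generalizing J x y l with
  | zero =>
    have : ∀ p : Q, ∃ w β q γ, W.Run p w β q ∧ (q, γ) ∈ W.final := by
      intro p
      obtain ⟨_, r, _, v, _, _, γ, δ, _, _, h, h'⟩ := hW p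
      exact ⟨v, γ, r, δ, h, h'⟩
    choose w β q γ hr hq using this
    refine ⟨fun j => w (x j).1, fun j => (x j).2 * β (x j).1 * γ (x j).1,
      fun j _ => ⟨_, _, _, hr _, hq _, rfl⟩, fun i hi j hj hij => ?_⟩
    have := hs i hi j hj hij
    rw [List.length_eq_zero_iff.1 (Nat.le_zero.1 (hN i hi))] at this
    simp [Separated] at this
  | succ N ih =>
    by_cases hJ : J.card ≤ 1
    · refine ih J x x (fun _ => []) (fun _ _ => by simp) (fun _ _ => .nil _) ?_
      exact fun i hi j hj hij => absurd (Finset.card_le_one.1 hJ i hi j hj) hij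
    push Not at hJ
    obtain ⟨i₀, hi₀, i₁, hi₁, h01⟩ := Finset.one_lt_card.1 hJ
    obtain ⟨u, v, hd⟩ := exists_common_head J l hJ hs
    choose! c t ht using hd
    have htr : ∀ j ∈ J, ∃ q α β, W.Run (x j).1 u α q ∧ W.Run q v β q ∧
        c j = (x j).2 * α * β * ((x j).2 * α)⁻¹ ∧ W.Trace (q, (x j).2 * α) (t j) (y j) := by
      intro j hj
      have := hl j hj
      rw [ht j hj] at this
      exact this.exists_of_cons
    have : Nonempty Q := ⟨(x i₀).1⟩
    choose! q α β hu hv hc htr using htr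
    have hlen : ∀ j ∈ J, (t j).length ≤ N := by
      intro j hj
      have := hN j hj
      rw [ht j hj] at this
      simpa using this
    have hst : ∀ i ∈ J, ∀ j ∈ J, i ≠ j → c i ≠ c j ∨ Separated (t i) (t j) := by
      intro i hi j hj hij
      have := hs i hi j hj hij
      rw [ht i hi, ht j hj] at this
      exact this.2.2
    have hcls := fun d => ih (J.filter (c · = d)) (fun j => (q j, (x j).2 * α j)) y t
      (fun j hj => hlen j (Finset.mem_filter.1 hj).1)
      (fun j hj => htr j (Finset.mem_filter.1 hj).1) (by
        intro i hi j hj hij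
        rw [Finset.mem_filter] at hi hj
        exact (hst i hi.1 j hj.1 hij).resolve_left fun h => h (hi.2.trans hj.2.symm))
    choose w' o' hrun hfar using hcls
    set w₁ : ι → List A := fun j => w' (c j) j with hw₁
    set o₁ : ι → G := fun j => o' (c j) j with ho₁
    -- the finitely many exponents that do not move two traces with different loops far apart
    have hbad : ∀ i j, c i ≠ c j → {n : ℕ | cayleyLength Γ
        ((o₁ i)⁻¹ * ((c i ^ n)⁻¹ * c j ^ n) * o₁ j) ≤
          L * (wordDist (w₁ i) (w₁ j) + 1)}.Finite := by
      intro i j hij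
      refine ((finite_cayleyLength_le hΓ hf
        (L * (wordDist (w₁ i) (w₁ j) + 1))).preimage (Set.injOn_of_injective ?_) :
        ((fun n : ℕ => (o₁ i)⁻¹ * ((c i ^ n)⁻¹ * c j ^ n) * o₁ j) ⁻¹' _).Finite)
      intro m n hmn
      exact hG.injective_inv_pow_mul_pow hij (mul_left_cancel (mul_right_cancel hmn))
    have hbad' : (⋃ p ∈ (J ×ˢ J).filter (fun p => c p.1 ≠ c p.2),
        {n : ℕ | cayleyLength Γ
        ((o₁ p.1)⁻¹ * ((c p.1 ^ n)⁻¹ * c p.2 ^ n) * o₁ p.2) ≤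
          L * (wordDist (w₁ p.1) (w₁ p.2) + 1)}).Finite :=
      Set.Finite.biUnion (Finset.finite_toSet _) fun p hp =>
        hbad _ _ (Finset.mem_filter.1 hp).2
    obtain ⟨n, hn⟩ := hbad'.exists_notMem
    refine ⟨fun j => (u ++ (List.replicate n v).flatten) ++ w₁ j, fun j => c j ^ n * o₁ j,
      fun j hj => ?_, fun i hi j hj hij => ?_⟩
    · obtain ⟨β', r, γ, h1, h2, h3⟩ := hrun (c j) j (Finset.mem_filter.2 ⟨hj, rfl⟩)
      refine ⟨_, r, γ, ((hu j hj).append ((hv j hj).flatten_replicate n)).append h1, h2, ?_⟩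
      simp only [ho₁]
      rw [h3]
      nth_rw 1 [hc j hj]
      rw [conj_pow]
      group
    · rw [wordDist_append_left]
      have e : (c i ^ n * o₁ i)⁻¹ * (c j ^ n * o₁ j) =
          (o₁ i)⁻¹ * ((c i ^ n)⁻¹ * c j ^ n) * o₁ j := by group
      rw [e]
      by_cases h : c i = c j
      · have := hfar (c i) i (Finset.mem_filter.2 ⟨hi, rfl⟩) j
          (Finset.mem_filter.2 ⟨hj, h.symm⟩) hij
        simpa [hw₁, ho₁, ← h] using this
      · by_contra! hle
        refine hn (Set.mem_biUnion (x := (i, j)) ?_ hle)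
        exact Finset.mem_filter.2 ⟨Finset.mem_product.2 ⟨hi, hj⟩, h⟩

theorem btp_of_lipschitz (hG : IsInfinitary G) (hΓ : Subgroup.closure Γ = ⊤) (hf : Γ.Finite)
    (hW : W.IsTrim) {k : ℕ} (h : LipschitzOfOrder Γ k W.rel) : W.BTP k := by
  rw [btp_iff]
  rintro ⟨x, y, l, hx, hl, hs⟩
  obtain ⟨L, hL⟩ := h
  obtain ⟨w, o, hr, hfar⟩ := Trace.exists_far hG hΓ hf hW L _ Finset.univ x y l
    (fun j hj => Finset.le_sup (f := fun j => (l j).length) hj) (fun j _ => hl j)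
    (fun i _ j _ hij => hs hij)
  obtain ⟨i, j, hij, hle⟩ := hL (fun j => (w j, o j)) fun j => by
    obtain ⟨β, q, γ, h1, h2, h3⟩ := hr j (Finset.mem_univ _)
    exact ⟨(x j).1, q, (x j).2, β, γ, hx j, h1, h2, h3⟩
  rw [cayleyDist_eq] at hle
  exact absurd hle (not_le.2 (hfar i (Finset.mem_univ _) j (Finset.mem_univ _) hij.ne))

end WeightedAutomaton

end Pumping

/-! ### Relations computed by sequential automata are Lipschitz -/

section Sequential

namespace WeightedAutomaton

theorem mem_rel_union {A M : Type*} [Monoid M] {k : ℕ} {Q : Fin k → Type*}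
    (V : ∀ i, WeightedAutomaton A (Q i) M) (x : List A × M) :
    x ∈ (union V).rel ↔ ∃ i, x ∈ (V i).rel := by
  have hrun : ∀ {p q : Σ i, Q i} {w : List A} {β : M}, (union V).Run p w β q →
      ∃ q', q = ⟨p.1, q'⟩ ∧ (V p.1).Run p.2 w β q' := by
    intro p q w β h
    induction h with
    | nil p => exact ⟨p.2, rfl, .nil _⟩
    | cons ht _ ih =>
      obtain ⟨r', rfl, h'⟩ := ih
      obtain ⟨i, ⟨p', a, α, q'⟩, ht', heq⟩ := Set.mem_iUnion.1 ht
      simp only [Prod.mk.injEq] at heq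
      obtain ⟨rfl, rfl, rfl, rfl⟩ := heq
      exact ⟨r', rfl, .cons ht' h'⟩
  have hrun' : ∀ {i} {p q : Q i} {w : List A} {β : M}, (V i).Run p w β q →
      (union V).Run ⟨i, p⟩ w β ⟨i, q⟩ := by
    intro i p q w β h
    induction h with
    | nil p => exact .nil _
    | cons ht _ ih => exact .cons (Set.mem_iUnion.2 ⟨i, _, ht, rfl⟩) ih
  constructor
  · rintro ⟨p, q, α, β, γ, hp, hr, hq, hx⟩
    obtain ⟨i, ⟨p', α'⟩, hp', heq⟩ := Set.mem_iUnion.1 hp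
    simp only [Prod.mk.injEq] at heq
    obtain ⟨rfl, rfl⟩ := heq
    obtain ⟨q', rfl, hr'⟩ := hrun hr
    obtain ⟨j, ⟨q'', γ'⟩, hq', heq⟩ := Set.mem_iUnion.1 hq
    simp only [Prod.mk.injEq, Sigma.mk.injEq] at heq
    obtain ⟨⟨rfl, h⟩, rfl⟩ := heq
    obtain rfl := eq_of_heq h
    exact ⟨j, p', q'', _, β, _, hp', hr', hq', hx⟩
  · rintro ⟨i, p, q, α, β, γ, hp, hr, hq, hx⟩
    exact ⟨⟨i, p⟩, ⟨i, q⟩, α, β, γ, Set.mem_iUnion.2 ⟨i, _, hp, rfl⟩, hrun' hr,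
      Set.mem_iUnion.2 ⟨i, _, hq, rfl⟩, hx⟩

variable {A Q G : Type*} [Group G] {Γ : Set G}

theorem Run.cayleyLength_le (hΓ : Subgroup.closure Γ = ⊤) {W : WeightedAutomaton A Q G} {C : ℕ}
    (hC : ∀ t ∈ W.trans, cayleyLength Γ t.2.2.1 ≤ C) {p q : Q} {w : List A} {β : G}
    (h : W.Run p w β q) : cayleyLength Γ β ≤ C * w.length := by
  induction h with
  | nil p => simp [cayleyLength_one]
  | cons ht _ ih =>
    refine (cayleyLength_mul hΓ _ _).trans ?_
    have := hC _ ht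
    rw [List.length_cons, mul_add]
    simp only at this
    omega

theorem IsSequential.cayleyLength_le (hΓ : Subgroup.closure Γ = ⊤) {W : WeightedAutomaton A Q G}
    (hW : W.IsSequential) {C : ℕ} (hC : ∀ t ∈ W.trans, cayleyLength Γ t.2.2.1 ≤ C)
    {p q q' : Q} {w w' : List A} {β β' : G} (h : W.Run p w β q) (h' : W.Run p w' β' q') :
    cayleyLength Γ (β⁻¹ * β') ≤ C * wordDist w w' := by
  induction h generalizing w' β' q' with
  | nil p =>
    have := h'.cayleyLength_le hΓ hC
    simpa [wordDist, lcp] using this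
  | @cons p q r a w α β ht hr ih =>
    have hsplit : ∀ b w'', lcp (a :: w) (b :: w'') = [] →
        ∀ β'', W.Run p (b :: w'') β'' q' →
        cayleyLength Γ ((α * β)⁻¹ * β'') ≤ C * wordDist (a :: w) (b :: w'') := by
      intro b w'' hl β'' h''
      refine (cayleyLength_mul hΓ _ _).trans ?_
      rw [cayleyLength_inv]
      have h1 := (Run.cons ht hr).cayleyLength_le hΓ hC
      have h2 := h''.cayleyLength_le hΓ hC
      rw [wordDist, hl, List.length_nil, Nat.mul_zero, Nat.sub_zero, mul_add]
      omega
    cases h' with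
    | nil =>
      have := (Run.cons ht hr).cayleyLength_le hΓ hC
      simpa [wordDist, lcp, cayleyLength_inv, -mul_inv_rev] using this
    | @cons _ q₁ _ b w' α' β' ht' hr' =>
      by_cases hab : a = b
      · subst hab
        obtain ⟨rfl, rfl⟩ := hW.2 _ _ _ _ _ _ ht ht'
        have := ih hr'
        have e : wordDist (a :: w) (a :: w') = wordDist w w' := wordDist_append_left [a] w w'
        rw [e]
        simpa [mul_assoc] using this
      · exact hsplit b w' (by simp [lcp, hab]) _ (.cons ht' hr')

theorem lipschitz_of_isKSequential (hΓ : Subgroup.closure Γ = ⊤) {k : ℕ}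
    {R : Set (List A × G)} (h : IsKSequential k R) : LipschitzOfOrder Γ k R := by
  obtain ⟨P, V, -, hV, rfl⟩ := h
  choose C hC using fun i => exists_cayleyLength_le_of_finite (Γ := Γ)
    ((V i).trans_finite.image fun t => t.2.2.1)
  choose D hD using fun i => exists_cayleyLength_le_of_finite (Γ := Γ)
    ((V i).final_finite.image Prod.snd)
  set L := Finset.univ.sup C + 2 * Finset.univ.sup D with hL
  refine ⟨L, fun x hx => ?_⟩
  choose i hi using fun j => (mem_rel_union V (x j)).1 (hx j)
  have key : ∀ j j', i j = i j' →
      cayleyDist Γ (x j).2 (x j').2 ≤ L * (wordDist (x j).1 (x j').1 + 1) := by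
    intro j j' hij
    have h1 := hi j
    have h2 := hi j'
    rw [← hij] at h2
    obtain ⟨⟨p₀, α₀⟩, hp₀⟩ := (hV (i j)).1
    obtain ⟨p, q, α, β, γ, hp, hr, hq, hx1⟩ := h1
    obtain ⟨p', q', α', β', γ', hp', hr', hq', hx2⟩ := h2
    rw [hp₀, Set.mem_singleton_iff, Prod.mk.injEq] at hp hp'
    obtain ⟨rfl, rfl⟩ := hp
    obtain ⟨rfl, rfl⟩ := hp'
    have hrun := (hV (i j)).cayleyLength_le hΓ (fun t ht => hC (i j) _ ⟨t, ht, rfl⟩) hr hr'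
    have hγ := hD (i j) γ ⟨_, hq, rfl⟩
    have hγ' := hD (i j) γ' ⟨_, hq', rfl⟩
    have hCi : C (i j) ≤ Finset.univ.sup C := Finset.le_sup (Finset.mem_univ _)
    have hDi : D (i j) ≤ Finset.univ.sup D := Finset.le_sup (Finset.mem_univ _)
    rw [cayleyDist_eq, hx1, hx2]
    have e : (α' * β * γ)⁻¹ * (α' * β' * γ') = γ⁻¹ * (β⁻¹ * β') * γ' := by group
    rw [e]
    have t1 := cayleyLength_mul hΓ (γ⁻¹ * (β⁻¹ * β')) γ'
    have t2 := cayleyLength_mul hΓ γ⁻¹ (β⁻¹ * β')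
    rw [cayleyLength_inv] at t2
    have m1 := Nat.mul_le_mul_right (wordDist (x j).1 (x j').1) hCi
    have m2 : Finset.univ.sup C * wordDist (x j).1 (x j').1 ≤
        L * wordDist (x j).1 (x j').1 := Nat.mul_le_mul_right _ (by omega)
    rw [mul_add]
    omega
  obtain ⟨j, j', hne, heq⟩ := Fintype.exists_ne_map_eq_of_card_lt i (by simp)
  rcases lt_or_gt_of_ne hne with h | h
  · exact ⟨j, j', h, key j j' heq⟩
  · exact ⟨j', j, h, key j' j heq.symm⟩

end WeightedAutomaton

end Sequential

/-! ### Far configurations reached on a common word -/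

namespace WeightedAutomaton

section JointRuns

variable {A Q G : Type*} [Group G] {W : WeightedAutomaton A Q G} {Γ : Set G} {J : Type*}

/-- `W.JointRun Z p w β q`: runs of `W` on the same word `w`, indexed by `J`, such that the tuple of
the states of all runs stays in `Z`. -/
inductive JointRun (W : WeightedAutomaton A Q G) {J : Type*} (Z : Set (J → Q)) :
    (J → Q) → List A → (J → G) → (J → Q) → Prop
  | nil {p : J → Q} : p ∈ Z → JointRun W Z p [] 1 p
  | cons {p q r : J → Q} {a : A} {w : List A} {α β : J → G} : p ∈ Z →
      (∀ j, (p j, a, α j, q j) ∈ W.trans) → JointRun W Z q w β r →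
      JointRun W Z p (a :: w) (α * β) r

theorem JointRun.of_run {w : List A} {p q : J → Q} {β : J → G}
    (h : ∀ j, W.Run (p j) w (β j) (q j)) : W.JointRun Set.univ p w β q := by
  induction w generalizing p β with
  | nil =>
    have h1 : β = 1 := by
      funext j
      have := h j
      generalize β j = b at this ⊢
      generalize p j = p' at this
      generalize q j = q' at this
      cases this
      rfl
    have h2 : q = p := by
      funext j
      have := h j
      generalize β j = b at this
      generalize p j = p' at this ⊢
      generalize q j = q' at this ⊢
      cases this
      rfl
    rw [h1, h2]
    exact .nil trivial
  | cons a w ih =>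
    have : ∀ j, ∃ p' α β', β j = α * β' ∧ (p j, a, α, p') ∈ W.trans ∧ W.Run p' w β' (q j) := by
      intro j
      have := h j
      generalize β j = b at this ⊢
      generalize p j = p' at this ⊢
      generalize q j = q' at this ⊢
      cases this with
      | cons ht hr => exact ⟨_, _, _, rfl, ht, hr⟩
    choose p' α β' h1 h2 h3 using this
    obtain rfl : β = α * β' := funext h1
    exact .cons trivial h2 (ih h3)

theorem JointRun.start_mem {Z : Set (J → Q)} {w : List A} {p q : J → Q} {β : J → G}
    (h : W.JointRun Z p w β q) : p ∈ Z := by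
  cases h <;> assumption

/-- A joint run is cut at its last visit of the tuple `t` of states. -/
theorem JointRun.last_visit {Z : Set (J → Q)} {w : List A} {p q : J → Q} {β : J → G}
    (h : W.JointRun Z p w β q) (t : J → Q) :
    W.JointRun (Z \ {t}) p w β q ∨ ∃ w₁ α₁, (∀ j, W.Run (p j) w₁ (α₁ j) (t j)) ∧
      ((w = w₁ ∧ β = α₁ ∧ q = t) ∨ ∃ a w₂ α p' β₂, w = w₁ ++ a :: w₂ ∧ β = α₁ * (α * β₂) ∧
        (∀ j, (t j, a, α j, p' j) ∈ W.trans) ∧ W.JointRun (Z \ {t}) p' w₂ β₂ q) := by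
  induction h with
  | @nil p hp =>
    by_cases hpt : p = t
    · subst hpt
      exact Or.inr ⟨[], 1, fun j => .nil _, Or.inl ⟨rfl, rfl, rfl⟩⟩
    · exact Or.inl (.nil ⟨hp, hpt⟩)
  | @cons p p₁ q a w α β hp ht _ ih =>
    rcases ih with ih | ⟨w₁, α₁, h1, h2⟩
    · by_cases hpt : p = t
      · subst hpt
        exact Or.inr ⟨[], 1, fun j => .nil _, Or.inr ⟨a, w, α, p₁, β, rfl, by simp, ht, ih⟩⟩
      · exact Or.inl (.cons ⟨hp, hpt⟩ ht ih)
    · refine Or.inr ⟨a :: w₁, α * α₁, fun j => .cons (ht j) (h1 j), ?_⟩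
      rcases h2 with ⟨rfl, rfl, rfl⟩ | ⟨b, w₂, γ, p', β₂, rfl, rfl, h3, h4⟩
      · exact Or.inl ⟨rfl, rfl, rfl⟩
      · exact Or.inr ⟨b, w₂, γ, p', β₂, rfl, by simp [mul_assoc], h3, h4⟩

/-- Runs on a common word can be read as traces, by inspecting loops of the tuple of all runs, such
that runs with equal traces have delays that differ by a bounded amount: at the first visited tuple
of states, inspect the loop to its last visit, which does not affect the delay of such runs; then
make one step, and continue with the remaining tuples of states. -/
theorem JointRun.exists_trace [Finite J] [Finite Q] (hΓ : Subgroup.closure Γ = ⊤) {C : ℕ}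
    (hC : ∀ t ∈ W.trans, cayleyLength Γ t.2.2.1 ≤ C) {Z : Set (J → Q)} {N : ℕ}
    (hZ : Z.ncard ≤ N) {p q : J → Q} {w : List A} {β : J → G} (h : W.JointRun Z p w β q)
    (g : J → G) :
    ∃ l : J → List (List A × List A × G),
      (∀ j, W.Trace (p j, g j) (l j) (q j, g j * β j)) ∧
      (∀ i j, traceInput (l i) = traceInput (l j)) ∧
      ∀ i j, l i = l j → cayleyLength Γ ((g i * β i)⁻¹ * (g j * β j)) ≤
        cayleyLength Γ ((g i)⁻¹ * g j) + 2 * C * N := by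
  induction N generalizing Z p w β g with
  | zero =>
    have := h.start_mem
    rw [(Set.ncard_eq_zero (Set.toFinite _)).1 (Nat.le_zero.1 hZ)] at this
    exact absurd this (Set.notMem_empty _)
  | succ N ih =>
    rcases h.last_visit p with h' | ⟨w₁, α₁, h1, h2⟩
    · exact absurd rfl h'.start_mem.2
    have hloop : ∀ i j, g i * α₁ i * (g i)⁻¹ = g j * α₁ j * (g j)⁻¹ →
        (g i * α₁ i)⁻¹ * (g j * α₁ j) = (g i)⁻¹ * g j := fun i j hij =>
      ((delay_eq_iff (g i) (g j) (α₁ i) (α₁ j)).2 hij).symm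
    rcases h2 with ⟨rfl, rfl, rfl⟩ | ⟨a, w₂, α, p', β₂, rfl, rfl, h3, h4⟩
    · refine ⟨fun j => [([], w, g j * β j * (g j)⁻¹)] ++ [(w, [], 1)],
        fun j => (Trace.loop (h1 j) (g j)).append (Trace.single (h1 j) (g j)),
        fun i j => rfl, fun i j hij => ?_⟩
      rw [hloop i j (by simpa using hij)]
      exact Nat.le_add_right _ _
    · have hcard : (Z \ {p}).ncard ≤ N := by
        rw [Set.ncard_sdiff_singleton_of_mem h.start_mem]
        omega
      obtain ⟨l, hl1, hl2, hl3⟩ := ih hcard h4 (fun j => g j * α₁ j * α j)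
      refine ⟨fun j => [([], w₁, g j * α₁ j * (g j)⁻¹)] ++ ([(w₁, [], 1)] ++ ([([a], [], 1)] ++
        l j)), fun j => ?_, fun i j => ?_, fun i j hij => ?_⟩
      · have ha : W.Run (p j) [a] (α j) (p' j) := by
          simpa using Run.cons (h3 j) (.nil _)
        have := (Trace.loop (h1 j) (g j)).append ((Trace.single (h1 j) (g j)).append
          ((Trace.single ha (g j * α₁ j)).append (hl1 j)))
        simpa [mul_assoc] using this
      · simpa [traceInput] using hl2 i j
      · simp only [List.cons_append, List.nil_append, List.cons.injEq, Prod.mk.injEq,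
          true_and] at hij
        have e1 := hl3 i j hij.2
        have e2 := hloop i j hij.1
        have e3 : (g i * α₁ i * α i)⁻¹ * (g j * α₁ j * α j) =
            (α i)⁻¹ * ((g i)⁻¹ * g j) * α j := by
          rw [← e2]; group
        rw [e3] at e1
        have t1 := cayleyLength_mul hΓ ((α i)⁻¹ * ((g i)⁻¹ * g j)) (α j)
        have t2 := cayleyLength_mul hΓ (α i)⁻¹ ((g i)⁻¹ * g j)
        rw [cayleyLength_inv] at t2
        have c1 := hC _ (h3 i)
        have c2 := hC _ (h3 j)
        have e4 : ∀ j, g j * (α₁ * (α * β₂)) j = g j * α₁ j * α j * β₂ j := by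
          intro j; simp [mul_assoc]
        rw [e4, e4, mul_add]
        simp only at c1 c2
        omega

/-- The configurations that `W` reaches from the configurations in `R` by reading `w`. -/
def reach (W : WeightedAutomaton A Q G) (w : List A) (R : Set (Q × G)) : Set (Q × G) :=
  {y | ∃ x ∈ R, ∃ β, W.Run x.1 w β y.1 ∧ y.2 = x.2 * β}

/-- The delays between configurations in `X` have length at most `D`. -/
def DelayBounded (Γ : Set G) (X : Set (Q × G)) (D : ℕ) : Prop :=
  ∀ x ∈ X, ∀ y ∈ X, cayleyLength Γ (x.2⁻¹ * y.2) ≤ D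

/-- Configurations that are reached on the same word and are either far apart or continued by
separated traces give rise to pairwise separated traces. -/
theorem hasSeparated_of_reach [Finite J] [Finite Q] (hΓ : Subgroup.closure Γ = ⊤) {C N D : ℕ}
    (hC : ∀ t ∈ W.trans, cayleyLength Γ t.2.2.1 ≤ C) (hN : Nat.card (J → Q) ≤ N)
    {R : Set (Q × G)} (hR : DelayBounded Γ R D) {w : List A} {y z : J → Q × G}
    (hy : ∀ j, y j ∈ W.reach w R) {l : J → List (List A × List A × G)}
    (hl : ∀ j, W.Trace (y j) (l j) (z j))
    (hs : ∀ i j, i ≠ j → Separated (l i) (l j) ∨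
      D + 2 * C * N < cayleyLength Γ ((y i).2⁻¹ * (y j).2)) : W.HasSeparated R J := by
  choose x hx β hr hβ using hy
  obtain ⟨m, hm1, hm2, hm3⟩ := (JointRun.of_run hr).exists_trace hΓ hC
    ((Set.ncard_univ _).trans_le hN) fun j => (x j).2
  refine ⟨x, z, fun j => m j ++ l j, hx, fun j => ?_, fun i j hij => ?_⟩
  · refine (hm1 j).append ?_
    rw [← hβ j]
    exact hl j
  · rcases hs i j hij with h | h
    · exact Separated.append_left (hm2 i j) h
    · refine Separated.append_right _ _ (separated_of_ne (hm2 i j) fun heq => ?_)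
      have h1 := hm3 i j heq
      rw [← hβ, ← hβ] at h1
      have := hR _ (hx i) _ (hx j)
      omega

theorem HasSeparated.of_reach {R : Set (Q × G)} {w : List A} (h : W.HasSeparated (W.reach w R) J) :
    W.HasSeparated R J := by
  obtain ⟨y, z, l, hy, hl, hs⟩ := h
  choose x hx β hr hβ using hy
  refine ⟨x, z, fun j => [(w, [], 1)] ++ l j, hx, fun j => ?_, fun i j hij =>
    Separated.append_left rfl (hs hij)⟩
  refine (Trace.single (hr j) _).append ?_
  rw [← hβ]
  exact hl j

/-- If no `n + 1` traces starting in `R` are pairwise separated, then a set of configurations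
reached from `R` on a common word that is not bounded falls into two parts that are far
apart: otherwise, each of `n + 1` consecutive annuli around a configuration would contain another
configuration. -/
theorem exists_split [Finite Q] (hΓ : Subgroup.closure Γ = ⊤) {C N D n : ℕ}
    (hC : ∀ t ∈ W.trans, cayleyLength Γ t.2.2.1 ≤ C) (hN : Nat.card (Fin (n + 1) → Q) ≤ N)
    {R S : Set (Q × G)} (hR : DelayBounded Γ R D) {w : List A} (hS : S ⊆ W.reach w R)
    (hn : ¬ W.HasSeparated R (Fin (n + 1)))
    (hb : ¬ DelayBounded Γ S ((2 * n + 1) * (D + 2 * C * N))) :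
    ∃ S₁ S₂ : Set (Q × G), S = S₁ ∪ S₂ ∧ S₁.Nonempty ∧ S₂.Nonempty ∧
      ∀ s ∈ S₁, ∀ t ∈ S₂, D + 2 * C * N < cayleyLength Γ (s.2⁻¹ * t.2) := by
  unfold DelayBounded at hb
  push Not at hb
  obtain ⟨s, hs, t, ht, hst⟩ := hb
  set M := D + 2 * C * N with hM
  have htri : ∀ y z : Q × G, cayleyLength Γ (s.2⁻¹ * z.2) ≤
      cayleyLength Γ (s.2⁻¹ * y.2) + cayleyLength Γ (y.2⁻¹ * z.2) := by
    intro y z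
    have := cayleyLength_mul hΓ (s.2⁻¹ * y.2) (y.2⁻¹ * z.2)
    rwa [show s.2⁻¹ * y.2 * (y.2⁻¹ * z.2) = s.2⁻¹ * z.2 by group] at this
  by_cases hann : ∃ i : Fin (n + 1), ∀ z ∈ S, ¬ (2 * i * M < cayleyLength Γ (s.2⁻¹ * z.2) ∧
      cayleyLength Γ (s.2⁻¹ * z.2) ≤ 2 * i * M + M)
  · obtain ⟨i, hi⟩ := hann
    refine ⟨{z ∈ S | cayleyLength Γ (s.2⁻¹ * z.2) ≤ 2 * i * M},
      {z ∈ S | 2 * i * M + M < cayleyLength Γ (s.2⁻¹ * z.2)}, ?_, ⟨s, hs, ?_⟩, ⟨t, ht, ?_⟩, ?_⟩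
    · ext z
      simp only [Set.mem_union, Set.mem_ofPred_eq, ← and_or_left]
      refine ⟨fun hz => ⟨hz, ?_⟩, fun hz => hz.1⟩
      have := hi z hz
      by_contra! hcon
      exact this hcon
    · rw [inv_mul_cancel, cayleyLength_one]
      exact Nat.zero_le _
    · refine lt_of_le_of_lt ?_ hst
      have : (2 * (i : ℕ) + 1) * M ≤ (2 * n + 1) * M :=
        Nat.mul_le_mul_right _ (by have := i.2; omega)
      linarith
    · rintro y ⟨-, hy⟩ z ⟨-, hz⟩
      have := htri y z
      omega
  · push Not at hann
    choose y hy hlo hhi using hann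
    have hfar : ∀ i j : Fin (n + 1), i < j → M < cayleyLength Γ ((y i).2⁻¹ * (y j).2) := by
      intro i j hij
      have h1 := htri (y i) (y j)
      have h2 := hhi i
      have h3 := hlo j
      have h4 : (2 * (i : ℕ) + 2) * M ≤ 2 * j * M :=
        Nat.mul_le_mul_right _ (by have : (i : ℕ) < j := hij; omega)
      have h5 : (2 * (i : ℕ) + 2) * M = 2 * i * M + M + M := by ring
      omega
    refine absurd (hasSeparated_of_reach hΓ hC hN hR (fun j => hS (hy j)) (fun j => .nil (y j))
      fun i j hij => Or.inr ?_) hn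
    rcases lt_or_gt_of_ne hij with h | h
    · exact hfar i j h
    · rw [← cayleyLength_inv, show ((y i).2⁻¹ * (y j).2)⁻¹ = (y j).2⁻¹ * (y i).2 by group]
      exact hfar j i h

end JointRuns

/-! ### Degrees and admissible sets of configurations -/

section Degree

variable {A Q G : Type*} [Group G] {W : WeightedAutomaton A Q G} {Γ : Set G} {K : ℕ}

open Classical in
/-- The largest number, capped at `K`, of pairwise separated traces starting in `S`. -/
noncomputable def degree (W : WeightedAutomaton A Q G) (K : ℕ) (S : Set (Q × G)) : ℕ :=
  Nat.findGreatest (fun n => W.HasSeparated S (Fin n)) K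

theorem degree_le (S : Set (Q × G)) : W.degree K S ≤ K := by
  classical
  exact Nat.findGreatest_le _

theorem hasSeparated_degree (S : Set (Q × G)) : W.HasSeparated S (Fin (W.degree K S)) := by
  classical
  exact Nat.findGreatest_spec (P := fun n => W.HasSeparated S (Fin n)) (Nat.zero_le K)
    ⟨Fin.elim0, Fin.elim0, Fin.elim0, fun i => i.elim0, fun i => i.elim0, fun i => i.elim0⟩

theorem HasSeparated.of_le {S : Set (Q × G)} {m n : ℕ} (h : W.HasSeparated S (Fin n))
    (hmn : m ≤ n) : W.HasSeparated S (Fin m) :=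
  h.of_injective (Fin.castLE_injective hmn)

theorem not_hasSeparated_of_degree_lt {S : Set (Q × G)} {n : ℕ} (h : W.degree K S < n)
    (hn : W.degree K S < K) : ¬ W.HasSeparated S (Fin n) := by
  classical
  intro h'
  exact Nat.findGreatest_is_greatest (P := fun n => W.HasSeparated S (Fin n))
    (Nat.lt_succ_self (W.degree K S)) hn (h'.of_le h)

theorem le_degree {S : Set (Q × G)} {n : ℕ} (hn : n ≤ K) (h : W.HasSeparated S (Fin n)) :
    n ≤ W.degree K S := by
  classical
  exact Nat.le_findGreatest (P := fun n => W.HasSeparated S (Fin n)) hn h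

theorem degree_mono {S S' : Set (Q × G)}
    (h : ∀ n : ℕ, W.HasSeparated S (Fin n) → W.HasSeparated S' (Fin n)) :
    W.degree K S ≤ W.degree K S' :=
  le_degree (degree_le S) (h _ (hasSeparated_degree S))

theorem one_le_degree {S : Set (Q × G)} (hK : 1 ≤ K) (hS : S.Nonempty) : 1 ≤ W.degree K S := by
  obtain ⟨x, hx⟩ := hS
  exact le_degree hK ⟨fun _ => x, fun _ => x, fun _ => [], fun _ => hx, fun _ => .nil _,
    fun i j hij => absurd (Subsingleton.elim i j) hij⟩

/-- Multiply the outputs of configurations by `h` from the left. -/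
def shift (h : G) (X : Set (Q × G)) : Set (Q × G) := {x | (x.1, h⁻¹ * x.2) ∈ X}

theorem mem_shift {h : G} {X : Set (Q × G)} {x : Q × G} :
    x ∈ shift h X ↔ (x.1, h⁻¹ * x.2) ∈ X := Iff.rfl

theorem shift_shift_inv (h : G) (X : Set (Q × G)) : shift h (shift h⁻¹ X) = X := by
  ext x; simp [mem_shift]

theorem shift_inv_shift (h : G) (X : Set (Q × G)) : shift h⁻¹ (shift h X) = X := by
  ext x; simp [mem_shift]

theorem HasSeparated.shift {S : Set (Q × G)} {J : Type*} (h : W.HasSeparated S J) (a : G) :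
    W.HasSeparated (shift a S) J := by
  obtain ⟨x, y, l, hx, hl, hs⟩ := h
  exact ⟨fun j => ((x j).1, a * (x j).2), fun j => ((y j).1, a * (y j).2), _,
    fun j => by simpa [mem_shift] using hx j, fun j => (hl j).mul_left a,
    fun i j hij => (hs hij).conj a⟩

theorem degree_shift (S : Set (Q × G)) (a : G) : W.degree K (shift a S) = W.degree K S :=
  le_antisymm (degree_mono fun n h => by simpa only [shift_inv_shift] using h.shift a⁻¹)
    (degree_mono fun n h => h.shift a)

theorem DelayBounded.shift {X : Set (Q × G)} {D : ℕ} (h : DelayBounded Γ X D) (a : G) :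
    DelayBounded Γ (shift a X) D := by
  intro x hx y hy
  have := h _ hx _ hy
  simp only at this
  rwa [show (a⁻¹ * x.2)⁻¹ * (a⁻¹ * y.2) = x.2⁻¹ * y.2 by group] at this

theorem DelayBounded.mono {X : Set (Q × G)} {D D' : ℕ} (h : DelayBounded Γ X D) (hD : D ≤ D') :
    DelayBounded Γ X D' := fun x hx y hy => (h x hx y hy).trans hD

theorem DelayBounded.subset {X X' : Set (Q × G)} {D : ℕ} (h : DelayBounded Γ X D) (hX : X' ⊆ X) :
    DelayBounded Γ X' D := fun x hx y hy => h x (hX hx) y (hX hy)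

theorem shift_subset_reach {X R : Set (Q × G)} {w : List A} (h : X ⊆ W.reach w R) (a : G) :
    shift a X ⊆ W.reach w (shift a R) := by
  intro y hy
  obtain ⟨x, hx, β, hr, hβ⟩ := h hy
  refine ⟨(x.1, a * x.2), by simpa [mem_shift] using hx, β, hr, ?_⟩
  simp only at hβ
  rw [mul_assoc, ← hβ]
  group

/-- The configurations reached from `X` by one transition with letter `a`. -/
def succs (W : WeightedAutomaton A Q G) (a : A) (X : Set (Q × G)) : Set (Q × G) :=
  {y | ∃ p g α, (p, g) ∈ X ∧ (p, a, α, y.1) ∈ W.trans ∧ y.2 = g * α}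

theorem succs_subset_reach {X R : Set (Q × G)} {w : List A} (h : X ⊆ W.reach w R) (a : A) :
    W.succs a X ⊆ W.reach (w ++ [a]) R := by
  rintro y ⟨p, g, α, hp, ht, hy⟩
  obtain ⟨x, hx, β, hr, hβ⟩ := h hp
  refine ⟨x, hx, β * α, hr.append (by simpa using Run.cons ht (.nil _)), ?_⟩
  simp only at hβ
  rw [hy, hβ, mul_assoc]

theorem subset_reach_nil (X : Set (Q × G)) : X ⊆ W.reach [] X :=
  fun x hx => ⟨x, hx, 1, .nil _, by simp⟩

theorem DelayBounded.succs (hΓ : Subgroup.closure Γ = ⊤) {C : ℕ}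
    (hC : ∀ t ∈ W.trans, cayleyLength Γ t.2.2.1 ≤ C) {X : Set (Q × G)} {D : ℕ}
    (h : DelayBounded Γ X D) (a : A) : DelayBounded Γ (W.succs a X) (D + 2 * C) := by
  rintro y ⟨p, g, α, hp, ht, hy⟩ y' ⟨p', g', α', hp', ht', hy'⟩
  have h0 := h _ hp _ hp'
  have c1 := hC _ ht
  have c2 := hC _ ht'
  rw [hy, hy', show (g * α)⁻¹ * (g' * α') = α⁻¹ * (g⁻¹ * g') * α' by group]
  have t1 := cayleyLength_mul hΓ (α⁻¹ * (g⁻¹ * g')) α'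
  have t2 := cayleyLength_mul hΓ α⁻¹ (g⁻¹ * g')
  rw [cayleyLength_inv] at t2
  simp only at h0 c1 c2
  omega

/-- A set `X` of configurations is admissible for the bounds `D` if it is reached on a common word
from a set `R` that admits no more pairwise separated traces than `X`, and if the delays in `R` and
`X` are bounded as prescribed by `D` and the degree of `X`. -/
def Admissible (W : WeightedAutomaton A Q G) (Γ : Set G) (K M : ℕ) (D : ℕ → ℕ)
    (X : Set (Q × G)) : Prop :=
  DelayBounded Γ X ((2 * K + 1) * (D (W.degree K X) + M)) ∧
  ∃ R w, X ⊆ W.reach w R ∧ DelayBounded Γ R (D (W.degree K X)) ∧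
    ¬ W.HasSeparated R (Fin (W.degree K X + 1))

theorem Admissible.shift {M : ℕ} {D : ℕ → ℕ} {X : Set (Q × G)} (h : W.Admissible Γ K M D X)
    (a : G) : W.Admissible Γ K M D (shift a X) := by
  obtain ⟨h1, R, w, h2, h3, h4⟩ := h
  rw [Admissible, degree_shift]
  refine ⟨h1.shift a, WeightedAutomaton.shift a R, w, shift_subset_reach h2 a, h3.shift a,
    fun h5 => h4 ?_⟩
  simpa only [shift_inv_shift] using h5.shift a⁻¹

theorem admissible_of_delayBounded {M : ℕ} {D : ℕ → ℕ} {X : Set (Q × G)}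
    (hX : DelayBounded Γ X (D (W.degree K X)))
    (hn : ¬ W.HasSeparated X (Fin (W.degree K X + 1))) : W.Admissible Γ K M D X := by
  refine ⟨hX.mono ?_, X, [], subset_reach_nil X, hX, hn⟩
  calc D (W.degree K X) ≤ D (W.degree K X) + M := Nat.le_add_right _ _
    _ = 1 * (D (W.degree K X) + M) := (one_mul _).symm
    _ ≤ _ := Nat.mul_le_mul_right _ (by omega)

/-- The successors of an admissible set are the union of two admissible sets whose degrees add up
to at most the degree of the given set. -/
theorem Admissible.succs [Finite Q] (hΓ : Subgroup.closure Γ = ⊤) {C N : ℕ}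
    (hC : ∀ t ∈ W.trans, cayleyLength Γ t.2.2.1 ≤ C) (hN : ∀ n ≤ K, Nat.card (Fin (n + 1) → Q) ≤ N)
    {D : ℕ → ℕ}
    (hD : ∀ n ≤ K, ∀ m < n, (2 * K + 1) * (D n + 2 * C * N) + 2 * C ≤ D m)
    {X : Set (Q × G)} (h : W.Admissible Γ K (2 * C * N) D X) (a : A) :
    ∃ S₁ S₂, W.succs a X = S₁ ∪ S₂ ∧ W.Admissible Γ K (2 * C * N) D S₁ ∧
      W.Admissible Γ K (2 * C * N) D S₂ ∧ W.degree K S₁ + W.degree K S₂ ≤ W.degree K X := by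
  obtain ⟨hX, R, w, hR, hRD, hRn⟩ := h
  set n := W.degree K X with hn
  have hnK : n ≤ K := degree_le X
  have hS : W.succs a X ⊆ W.reach (w ++ [a]) R := succs_subset_reach hR a
  have hSX : W.succs a X ⊆ W.reach ([] ++ [a]) X := succs_subset_reach (subset_reach_nil X) a
  have hSb := hX.succs hΓ hC a
  have hsmall : ∀ S ⊆ W.succs a X, W.degree K S < n → W.Admissible Γ K (2 * C * N) D S := by
    intro S hSS hlt
    exact admissible_of_delayBounded ((hSb.subset hSS).mono (hD n hnK _ hlt))
      (not_hasSeparated_of_degree_lt (Nat.lt_succ_self _) (hlt.trans_le hnK))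
  have hempty : W.degree K (∅ : Set (Q × G)) = 0 := by
    by_contra hne
    obtain ⟨x, _, _, hx, _⟩ := hasSeparated_degree (W := W) (K := K) (∅ : Set (Q × G))
    exact hx ⟨0, Nat.pos_of_ne_zero hne⟩
  have hemp : W.Admissible Γ K (2 * C * N) D ∅ := by
    refine admissible_of_delayBounded (fun x hx => absurd hx (Set.notMem_empty x)) ?_
    rintro ⟨x, _, _, hx, _⟩
    exact hx 0
  have hle : W.degree K (W.succs a X) ≤ n := degree_mono fun m hm => (hm.mono hSX).of_reach
  rcases hle.lt_or_eq with hlt | heq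
  · exact ⟨W.succs a X, ∅, by simp, hsmall _ subset_rfl hlt, hemp, by rw [hempty]; exact hle⟩
  by_cases hb : DelayBounded Γ (W.succs a X) ((2 * K + 1) * (D n + 2 * C * N))
  · refine ⟨W.succs a X, ∅, by simp, ?_, hemp, by rw [hempty]; exact hle⟩
    rw [Admissible, heq]
    exact ⟨hb, R, _, hS, hRD, hRn⟩
  · have hb' : ¬ DelayBounded Γ (W.succs a X) ((2 * n + 1) * (D n + 2 * C * N)) :=
      fun h => hb (h.mono (Nat.mul_le_mul_right _ (by omega)))
    obtain ⟨S₁, S₂, hSe, h1, h2, hfar⟩ := exists_split hΓ hC (hN n hnK) hRD hS hRn hb'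
    have hsub1 : S₁ ⊆ W.succs a X := hSe ▸ Set.subset_union_left
    have hsub2 : S₂ ⊆ W.succs a X := hSe ▸ Set.subset_union_right
    have hsum : W.degree K S₁ + W.degree K S₂ ≤ n := by
      by_contra! hcon
      obtain ⟨n₁, n₂, hn1, hn2, hn12⟩ : ∃ n₁ n₂, n₁ ≤ W.degree K S₁ ∧ n₂ ≤ W.degree K S₂ ∧
          n₁ + n₂ = n + 1 := by
        rcases le_total (W.degree K S₁) (n + 1) with h | h
        · exact ⟨W.degree K S₁, n + 1 - W.degree K S₁, le_rfl, by omega, by omega⟩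
        · exact ⟨n + 1, 0, h, Nat.zero_le _, rfl⟩
      obtain ⟨y₁, z₁, l₁, hy1, hl1, hs1⟩ := (hasSeparated_degree (W := W) (K := K) S₁).of_le hn1
      obtain ⟨y₂, z₂, l₂, hy2, hl2, hs2⟩ := (hasSeparated_degree (W := W) (K := K) S₂).of_le hn2
      have hcard : Nat.card (Fin n₁ ⊕ Fin n₂ → Q) ≤ N := by
        have e := Nat.card_congr (Equiv.arrowCongr (finSumFinEquiv (m := n₁) (n := n₂))
          (Equiv.refl Q))
        rw [e, hn12]
        exact hN n hnK
      have key : W.HasSeparated R (Fin n₁ ⊕ Fin n₂) := by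
        refine hasSeparated_of_reach hΓ hC hcard hRD (y := Sum.elim y₁ y₂) (z := Sum.elim z₁ z₂)
          (l := Sum.elim l₁ l₂) (w := w ++ [a]) ?_ ?_ ?_
        · rintro (j | j)
          · exact hS (hsub1 (hy1 j))
          · exact hS (hsub2 (hy2 j))
        · rintro (j | j)
          · exact hl1 j
          · exact hl2 j
        · rintro (i | i) (j | j) hij
          · exact Or.inl (hs1 fun h => hij (by rw [h]))
          · exact Or.inr (hfar _ (hy1 i) _ (hy2 j))
          · right
            rw [← cayleyLength_inv, mul_inv_rev, inv_inv]
            exact hfar _ (hy1 j) _ (hy2 i)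
          · exact Or.inl (hs2 fun h => hij (by rw [h]))
      refine hRn (key.of_injective (f := fun j => finSumFinEquiv.symm (Fin.cast hn12.symm j)) ?_)
      exact finSumFinEquiv.symm.injective.comp (Fin.cast_injective _)
    have hK : 1 ≤ K := by
      by_contra! hK
      have : n = 0 := by omega
      rw [this] at hRn
      obtain ⟨x, hx⟩ := h1
      exact hRn (HasSeparated.of_reach (w := w ++ [a]) ⟨fun _ => x, fun _ => x, fun _ => [],
        fun _ => hS (hsub1 hx), fun _ => .nil _, fun i j hij => absurd (Fin.ext (by omega)) hij⟩)
    have d1 := one_le_degree (W := W) hK h1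
    have d2 := one_le_degree (W := W) hK h2
    exact ⟨S₁, S₂, hSe, hsmall _ hsub1 (by omega), hsmall _ hsub2 (by omega), hsum⟩

/-- Bounds on delays for each degree that leave room for one step beyond the bounds of all larger
degrees. -/
theorem exists_delay_bounds (K M C D₀ : ℕ) : ∃ D : ℕ → ℕ, (∀ n, D₀ ≤ D n) ∧
    ∀ n ≤ K, ∀ m < n, (2 * K + 1) * (D n + M) + C ≤ D m := by
  let e : ℕ → ℕ := fun j => Nat.rec D₀ (fun _ e => (2 * K + 1) * (e + M) + C) j
  have he : ∀ j, e (j + 1) = (2 * K + 1) * (e j + M) + C := fun j => rfl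
  have hmono : Monotone e := by
    refine monotone_nat_of_le_succ fun j => ?_
    rw [he]
    have : 1 * (e j + M) ≤ (2 * K + 1) * (e j + M) := Nat.mul_le_mul_right _ (by omega)
    omega
  refine ⟨fun n => e (K - n), fun n => hmono (Nat.zero_le _), fun n hn m hm => ?_⟩
  rw [← he]
  exact hmono (show K - n + 1 ≤ K - m by omega)

end Degree

end WeightedAutomaton

namespace WeightedAutomaton

/-! ### Simulations -/

section Simulation

variable {A Q P G : Type*} [Group G]

/-- A set `B` of pairs `(q, Y)` of a state `q` of `W` and a set `Y` of pairs `(p, g)` is a simulation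
of `W` by `V` if it has the following closure properties. They express that what `W` outputs on a
word from `q` on is, for some `(p, g) ∈ Y`, the product of `g` and what `V` outputs from `p` on. -/
def IsSimulation (W : WeightedAutomaton A Q G) (V : WeightedAutomaton A P G)
    (B : Set (Q × Set (P × G))) : Prop :=
  (∀ q α, (q, α) ∈ W.init → ∃ Y, (q, Y) ∈ B ∧ ∀ p g, (p, g) ∈ Y → (p, α * g) ∈ V.init) ∧
  (∀ q Y a α q', (q, Y) ∈ B → (q, a, α, q') ∈ W.trans → ∃ Y', (q', Y') ∈ B ∧
    ∀ p' g', (p', g') ∈ Y' → ∃ p g h, (p, g) ∈ Y ∧ (p, a, h, p') ∈ V.trans ∧ g * h = α * g') ∧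
  ∀ q Y γ, (q, Y) ∈ B → (q, γ) ∈ W.final → ∃ p g h, (p, g) ∈ Y ∧ (p, h) ∈ V.final ∧ g * h = γ

/-- `W` is simulated by `V` if there is a finite simulation that only uses finite sets. -/
def Simulates (W : WeightedAutomaton A Q G) (V : WeightedAutomaton A P G) : Prop :=
  ∃ B : Set (Q × Set (P × G)), B.Finite ∧ (∀ b ∈ B, b.2.Finite) ∧ IsSimulation W V B

theorem IsSimulation.rel_subset {W : WeightedAutomaton A Q G} {V : WeightedAutomaton A P G}
    {B : Set (Q × Set (P × G))} (h : IsSimulation W V B) : W.rel ⊆ V.rel := by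
  obtain ⟨hi, ht, hf⟩ := h
  have key : ∀ {q w β r}, W.Run q w β r → ∀ {γ}, (r, γ) ∈ W.final → ∀ {Y}, (q, Y) ∈ B →
      ∃ p g β' p' h, (p, g) ∈ Y ∧ V.Run p w β' p' ∧ (p', h) ∈ V.final ∧
        g * (β' * h) = β * γ := by
    intro q w β r hr
    induction hr with
    | nil q =>
      intro γ hγ Y hY
      obtain ⟨p, g, h, h1, h2, h3⟩ := hf _ _ _ hY hγ
      exact ⟨p, g, 1, p, h, h1, .nil _, h2, by simpa using h3⟩
    | cons htr _ ih =>
      intro γ hγ Y hY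
      obtain ⟨Y', hY', hback⟩ := ht _ _ _ _ _ hY htr
      obtain ⟨p', g', β', r', h, h1, h2, h3, h4⟩ := ih hγ hY'
      obtain ⟨p, g, η, e1, e2, e3⟩ := hback _ _ h1
      refine ⟨p, g, η * β', r', h, e1, .cons e2 h2, h3, ?_⟩
      rw [mul_assoc η, ← mul_assoc g, e3, mul_assoc, h4, mul_assoc]
  rintro ⟨w, o⟩ ⟨q, r, α, β, γ, hq, hr, hγ, ho⟩
  obtain ⟨Y, hY, hback⟩ := hi q α hq
  obtain ⟨p, g, β', p', h, h1, h2, h3, h4⟩ := key hr hγ hY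
  refine ⟨p, p', α * g, β', h, hback _ _ h1, h2, h3, ?_⟩
  rw [mul_assoc, mul_assoc, h4, ho, mul_assoc]

theorem Simulates.rel_subset {W : WeightedAutomaton A Q G} {V : WeightedAutomaton A P G}
    (h : Simulates W V) : W.rel ⊆ V.rel :=
  let ⟨_, _, _, hB⟩ := h
  hB.rel_subset

end Simulation

/-! ### Construction of the sequential automata -/

section Construction

variable {A Q G : Type*} [Group G]

theorem mem_union_init {A M : Type*} {k : ℕ} {Q : Fin k → Type*}
    {V : ∀ i, WeightedAutomaton A (Q i) M} {x : (Σ i, Q i) × M} :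
    x ∈ (union V).init ↔ (x.1.2, x.2) ∈ (V x.1.1).init := by
  constructor
  · intro h
    obtain ⟨i, ⟨p, g⟩, hp, rfl⟩ := Set.mem_iUnion.1 h
    exact hp
  · exact fun h => Set.mem_iUnion.2 ⟨_, _, h, rfl⟩

theorem mem_union_final {A M : Type*} {k : ℕ} {Q : Fin k → Type*}
    {V : ∀ i, WeightedAutomaton A (Q i) M} {x : (Σ i, Q i) × M} :
    x ∈ (union V).final ↔ (x.1.2, x.2) ∈ (V x.1.1).final := by
  constructor
  · intro h
    obtain ⟨i, ⟨p, g⟩, hp, rfl⟩ := Set.mem_iUnion.1 h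
    exact hp
  · exact fun h => Set.mem_iUnion.2 ⟨_, _, h, rfl⟩

theorem mem_union_trans {A M : Type*} {k : ℕ} {Q : Fin k → Type*}
    {V : ∀ i, WeightedAutomaton A (Q i) M} {p q : Σ i, Q i} {a : A} {h : M} :
    (p, a, h, q) ∈ (union V).trans ↔
      ∃ i p' q', p = ⟨i, p'⟩ ∧ q = ⟨i, q'⟩ ∧ (p', a, h, q') ∈ (V i).trans := by
  constructor
  · intro ht
    obtain ⟨i, ⟨p', a', g, q'⟩, ht', heq⟩ := Set.mem_iUnion.1 ht
    simp only [Prod.mk.injEq] at heq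
    obtain ⟨rfl, rfl, rfl, rfl⟩ := heq
    exact ⟨i, p', q', rfl, rfl, ht'⟩
  · rintro ⟨i, p', q', rfl, rfl, ht⟩
    exact Set.mem_iUnion.2 ⟨i, _, ht, rfl⟩

/-- A subset construction. The elements `X` of the finite type `St` describe sets `conf X` of
configurations of `W`, closed up to translation under taking successors, where the successors may
also be split into two sets that share the number `deg X`. Then `W` is equivalent to `K`
sequential automata. Their states are pairs `(X, j)` with `j < K`; when the successors of `X` are
split into sets with numbers `d₁` and `d₂`, the states with `j < d₁` follow the first set, and
those with `d₁ ≤ j < d₁ + d₂` the second one. The automata differ only in the index `j` of the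
initial state. -/
theorem exists_sequential_of_subsets [Finite A] (W : WeightedAutomaton A Q G) {K : ℕ} {St : Type*}
    [Finite St] (conf : St → Set (Q × G)) (deg : St → ℕ) (hfin : ∀ X, (conf X).Finite)
    (hpos : ∀ X, (conf X).Nonempty → 1 ≤ deg X) (hK : ∀ X, deg X ≤ K)
    (hstep : ∀ X a, ∃ X₁ X₂ h₁ h₂, W.succs a (conf X) = shift h₁ (conf X₁) ∪ shift h₂ (conf X₂) ∧
      deg X₁ + deg X₂ ≤ deg X)
    {X₀ : St} {h₀ : G} (hinit : W.init = shift h₀ (conf X₀)) :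
    ∃ (n : ℕ) (V : Fin K → WeightedAutomaton A (Fin n) G), (∀ i, (V i).IsSequential) ∧
      Simulates W (union V) ∧ Simulates (union V) W := by
  classical
  choose X₁ X₂ h₁ h₂ hsucc hdeg using hstep
  obtain ⟨n, ⟨e⟩⟩ := Finite.exists_equiv_fin (St × Fin K)
  let next : St × Fin K → A → G × (St × Fin K) := fun x a =>
    if (x.2 : ℕ) < deg (X₁ x.1 a) then (h₁ x.1 a, (X₁ x.1 a, x.2))
    else (h₂ x.1 a, (X₂ x.1 a, ⟨x.2 - deg (X₁ x.1 a), (Nat.sub_le _ _).trans_lt x.2.2⟩))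
  let V : Fin K → WeightedAutomaton A (Fin n) G := fun i =>
    { init := {(e (X₀, i), h₀)}
      final := {x | ∃ q g γ, (q, g) ∈ conf (e.symm x.1).1 ∧ (q, γ) ∈ W.final ∧ x.2 = g * γ}
      trans := {t | next (e.symm t.1) t.2.1 = (t.2.2.1, e.symm t.2.2.2)}
      init_finite := Set.finite_singleton _
      final_finite := by
        refine (Set.finite_univ.prod (((Set.finite_iUnion hfin).prod W.final_finite).image
          fun z => z.1.2 * z.2.2)).subset ?_
        rintro ⟨p, g'⟩ ⟨q, g, γ, h1, h2, h3⟩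
        exact ⟨trivial, ((q, g), (q, γ)), ⟨Set.mem_iUnion.2 ⟨_, h1⟩, h2⟩, h3.symm⟩
      trans_finite := by
        refine (Set.finite_range fun x : Fin n × A => (x.1, x.2, (next (e.symm x.1) x.2).1,
          e (next (e.symm x.1) x.2).2)).subset ?_
        rintro ⟨p, a, g, q⟩ ht
        have ht' : next (e.symm p) a = (g, e.symm q) := ht
        exact ⟨(p, a), by simp [ht']⟩ }
  have hVt : ∀ i x a, (e x, a, (next x a).1, e (next x a).2) ∈ (V i).trans := by
    intro i x a
    show next (e.symm (e x)) a = _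
    simp
  refine ⟨n, V, fun i => ⟨⟨_, rfl⟩, ?_⟩, ?_, ?_⟩
  · intro p a α q α' q' ht ht'
    have h1 : next (e.symm p) a = (α, e.symm q) := ht
    have h2 : next (e.symm p) a = (α', e.symm q') := ht'
    rw [h1, Prod.mk.injEq] at h2
    exact ⟨h2.1, e.symm.injective h2.2⟩
  · -- the automaton with index `off + j` is in the state `(X, j)` while `W` is in `(q, g) ∈ conf X`
    let Y : St → ℕ → G → Set ((Σ _ : Fin K, Fin n) × G) := fun X off g =>
      {z | ∃ j : Fin K, (j : ℕ) < deg X ∧ (z.1.1 : ℕ) = off + j ∧ z.1.2 = e (X, j) ∧ z.2 = g⁻¹}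
    refine ⟨{b | ∃ X off g, (b.1, g) ∈ conf X ∧ off + deg X ≤ K ∧ b.2 = Y X off g},
      ?_, ?_, ?_, ?_, ?_⟩
    · refine ((Set.finite_univ.prod ((Set.finite_Iic K).prod (Set.finite_iUnion hfin))).image
        fun z : St × ℕ × Q × G => (z.2.2.1, Y z.1 z.2.1 z.2.2.2)).subset ?_
      rintro ⟨q, _⟩ ⟨X, off, g, h1, h2, rfl⟩
      exact ⟨(X, off, q, g), ⟨trivial, show off ≤ K by omega, Set.mem_iUnion.2 ⟨X, h1⟩⟩, rfl⟩
    · rintro ⟨q, _⟩ ⟨X, off, g, h1, h2, rfl⟩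
      refine (Set.finite_univ.prod (Set.finite_singleton g⁻¹)).subset ?_
      rintro ⟨z, g'⟩ ⟨j, -, -, -, h⟩
      exact ⟨trivial, h⟩
    · intro q α hq
      rw [hinit] at hq
      refine ⟨Y X₀ 0 (h₀⁻¹ * α), ⟨X₀, 0, h₀⁻¹ * α, hq, by simpa using hK X₀, rfl⟩, ?_⟩
      rintro ⟨i, p⟩ g ⟨j, hj, h1, h2, h3⟩
      refine mem_union_init.2 ?_
      obtain rfl : i = j := Fin.ext (by simpa using h1)
      simp only at h2 h3
      rw [h2, h3]
      show _ = _
      simp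
    · rintro q _ a α q' ⟨X, off, g, h1, h2, rfl⟩ ht
      have hmem : (q', g * α) ∈ W.succs a (conf X) := ⟨q, g, α, h1, ht, rfl⟩
      rw [hsucc] at hmem
      have hd := hdeg X a
      rcases hmem with hmem | hmem
      · refine ⟨_, ⟨X₁ X a, off, (h₁ X a)⁻¹ * (g * α), hmem, by omega, rfl⟩, ?_⟩
        rintro ⟨i, p⟩ g' ⟨j, hj, e1, e2, e3⟩
        simp only at e1 e2 e3
        have hn : next (X, j) a = (h₁ X a, (X₁ X a, j)) := if_pos hj
        have htr := hVt i (X, j) a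
        rw [hn] at htr
        refine ⟨⟨i, e (X, j)⟩, g⁻¹, h₁ X a, ⟨j, by omega, e1, rfl, rfl⟩,
          mem_union_trans.2 ⟨i, _, _, rfl, rfl, by rw [e2]; exact htr⟩, ?_⟩
        rw [e3]; group
      · refine ⟨_, ⟨X₂ X a, off + deg (X₁ X a), (h₂ X a)⁻¹ * (g * α), hmem, by omega, rfl⟩, ?_⟩
        rintro ⟨i, p⟩ g' ⟨j, hj, e1, e2, e3⟩
        simp only at e1 e2 e3
        have hlt : deg (X₁ X a) + j < K := by have := hK X; omega
        have hn : next (X, ⟨deg (X₁ X a) + j, hlt⟩) a = (h₂ X a, (X₂ X a, j)) := by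
          simp [next]
        have htr := hVt i (X, ⟨deg (X₁ X a) + j, hlt⟩) a
        rw [hn] at htr
        refine ⟨⟨i, e (X, ⟨deg (X₁ X a) + j, hlt⟩)⟩, g⁻¹, h₂ X a,
          ⟨⟨deg (X₁ X a) + j, hlt⟩, show deg (X₁ X a) + j < deg X by omega,
            by simp only; omega, rfl, rfl⟩,
          mem_union_trans.2 ⟨i, _, _, rfl, rfl, by rw [e2]; exact htr⟩, ?_⟩
        rw [e3]; group
    · rintro q _ γ ⟨X, off, g, h1, h2, rfl⟩ hγ
      have hd := hpos X ⟨_, h1⟩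
      have hK0 : 0 < K := by omega
      refine ⟨⟨⟨off, by omega⟩, e (X, ⟨0, hK0⟩)⟩, g⁻¹, g * γ, ⟨⟨0, hK0⟩, hd, rfl, rfl, rfl⟩,
        mem_union_final.2 ⟨q, g, γ, ?_, hγ, rfl⟩, by simp⟩
      simpa using h1
  · refine ⟨Set.range fun z : Σ _ : Fin K, Fin n => (z, conf (e.symm z.2).1),
      Set.finite_range _, ?_, ?_, ?_, ?_⟩
    · rintro _ ⟨z, rfl⟩
      exact hfin _
    · rintro ⟨i, p⟩ α hp
      have h1 : (p, α) = (e (X₀, i), h₀) := mem_union_init.1 hp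
      rw [Prod.mk.injEq] at h1
      obtain ⟨rfl, rfl⟩ := h1
      refine ⟨_, ⟨_, rfl⟩, fun q g hg => ?_⟩
      rw [hinit, mem_shift]
      simpa using hg
    · rintro z _ a α z' ⟨z₁, heq⟩ ht
      obtain ⟨rfl, rfl⟩ := Prod.mk.inj heq
      obtain ⟨i, p, p', rfl, rfl, ht'⟩ := mem_union_trans.1 ht
      have hn : next (e.symm p) a = (α, e.symm p') := ht'
      refine ⟨_, ⟨_, rfl⟩, fun q' g' hg' => ?_⟩
      set x := e.symm p
      set x' := e.symm p'
      have hmem : (q', α * g') ∈ W.succs a (conf x.1) := by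
        rw [hsucc]
        by_cases hlt : (x.2 : ℕ) < deg (X₁ x.1 a)
        · left
          have := hn.symm.trans (if_pos hlt)
          rw [Prod.mk.injEq] at this
          rw [this.1, mem_shift]
          rw [this.2] at hg'
          simpa using hg'
        · right
          have := hn.symm.trans (if_neg hlt)
          rw [Prod.mk.injEq] at this
          rw [this.1, mem_shift]
          rw [this.2] at hg'
          simpa using hg'
      obtain ⟨q, g, β, h1, h2, h3⟩ := hmem
      exact ⟨q, g, β, h1, h2, h3.symm⟩
    · rintro z _ γ ⟨z₁, heq⟩ hz
      obtain ⟨rfl, rfl⟩ := Prod.mk.inj heq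
      obtain ⟨q, g, γ', h1, h2, h3⟩ := mem_union_final.1 hz
      exact ⟨q, g, γ', h1, h2, h3.symm⟩

/-- An automaton with the branching twinning property of order `k ≥ 1` is equivalent to `k`
sequential automata: the subset construction, applied to the admissible sets of configurations,
normalized by a translation, is finite. -/
theorem BTP.exists_sequential [Finite A] [Finite Q] {Γ : Set G} (hΓ : Subgroup.closure Γ = ⊤)
    (hf : Γ.Finite) {W : WeightedAutomaton A Q G} {k : ℕ} (hk : 1 ≤ k) (h : W.BTP k) :
    ∃ (n : ℕ) (V : Fin k → WeightedAutomaton A (Fin n) G), (∀ i, (V i).IsSequential) ∧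
      Simulates W (union V) ∧ Simulates (union V) W := by
  rw [btp_iff] at h
  obtain ⟨C, hC⟩ := exists_cayleyLength_le_of_finite (Γ := Γ)
    (W.trans_finite.image fun t => t.2.2.1)
  replace hC : ∀ t ∈ W.trans, cayleyLength Γ t.2.2.1 ≤ C := fun t ht => hC _ ⟨t, ht, rfl⟩
  obtain ⟨D₀, hD₀⟩ := exists_cayleyLength_le_of_finite (Γ := Γ)
    ((W.init_finite.prod W.init_finite).image fun z => z.1.2⁻¹ * z.2.2)
  obtain ⟨N, hN⟩ : ∃ N, ∀ n ≤ k, Nat.card (Fin (n + 1) → Q) ≤ N :=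
    ⟨(Finset.range (k + 1)).sup fun n => Nat.card (Fin (n + 1) → Q), fun n hn =>
      Finset.le_sup (f := fun n => Nat.card (Fin (n + 1) → Q)) (Finset.mem_range.2 (by omega))⟩
  set M := 2 * C * N with hM
  obtain ⟨D, hD0, hD⟩ := exists_delay_bounds k M (2 * C) D₀
  have hDle : ∀ n ≤ k, D n ≤ D 0 := by
    intro n hn
    rcases Nat.eq_zero_or_pos n with rfl | hpos
    · exact le_rfl
    · refine le_trans ?_ (hD n hn 0 hpos)
      have : 1 * (D n + M) ≤ (2 * k + 1) * (D n + M) := Nat.mul_le_mul_right _ (by omega)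
      omega
  set T := (2 * k + 1) * (D 0 + M) with hT
  let St := {X : Set (Q × G) // W.Admissible Γ k M D X ∧ ∀ x ∈ X, cayleyLength Γ x.2 ≤ T}
  have hball : (Set.univ ×ˢ {g : G | cayleyLength Γ g ≤ T} : Set (Q × G)).Finite :=
    Set.finite_univ.prod (finite_cayleyLength_le hΓ hf T)
  have hsub : ∀ X : St, X.1 ⊆ (Set.univ ×ˢ {g : G | cayleyLength Γ g ≤ T} : Set (Q × G)) :=
    fun X x hx => ⟨trivial, X.2.2 x hx⟩
  have : Finite St :=
    (hball.finite_subsets.subset fun X hX => hsub ⟨X, hX⟩).to_subtype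
  have hnorm : ∀ S, W.Admissible Γ k M D S → ∃ (X : St) (a : G), S = shift a X.1 := by
    intro S hS
    rcases S.eq_empty_or_nonempty with rfl | ⟨s, hs⟩
    · exact ⟨⟨∅, hS, fun x hx => absurd hx (Set.notMem_empty x)⟩, 1, by ext; simp [mem_shift]⟩
    · refine ⟨⟨shift s.2⁻¹ S, hS.shift _, fun x hx => ?_⟩, s.2, (shift_shift_inv _ _).symm⟩
      have h1 := hS.1 _ hs _ (mem_shift.1 hx)
      simp only [inv_inv, inv_mul_cancel_left] at h1
      exact h1.trans (Nat.mul_le_mul_left _ (Nat.add_le_add_right (hDle _ (degree_le S)) _))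
  have hinit : W.Admissible Γ k M D W.init := by
    refine admissible_of_delayBounded (fun x hx y hy =>
      (hD₀ _ ⟨(x, y), ⟨hx, hy⟩, rfl⟩).trans (hD0 _)) ?_
    rcases (degree_le (W := W) (K := k) W.init).lt_or_eq with hlt | heq
    · exact not_hasSeparated_of_degree_lt (Nat.lt_succ_self _) hlt
    · rwa [heq]
  obtain ⟨X₀, h₀, hX₀⟩ := hnorm _ hinit
  refine exists_sequential_of_subsets W (fun X : St => X.1) (fun X => W.degree k X.1)
    (fun X => hball.subset (hsub X)) (fun X hX => one_le_degree hk hX) (fun X => degree_le _)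
    (fun X a => ?_) hX₀
  obtain ⟨S₁, S₂, hS, ha1, ha2, hd⟩ := X.2.1.succs hΓ hC hN hD a
  obtain ⟨X₁, h₁, rfl⟩ := hnorm _ ha1
  obtain ⟨X₂, h₂, rfl⟩ := hnorm _ ha2
  rw [degree_shift, degree_shift] at hd
  exact ⟨X₁, X₂, h₁, h₂, hS, hd⟩

theorem tfae [Finite A] [Finite Q] (hG : IsInfinitary G) {Γ : Set G}
    (hΓ : Subgroup.closure Γ = ⊤) (hf : Γ.Finite) (W : WeightedAutomaton A Q G) {k : ℕ}
    (hW : W.IsTrim) (hk : 1 ≤ k) :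
    List.TFAE [LipschitzOfOrder Γ k W.rel, W.BTP k, IsKSequential k W.rel] := by
  tfae_have 1 → 2 := btp_of_lipschitz hG hΓ hf hW
  tfae_have 2 → 3 := by
    intro h
    obtain ⟨n, V, hV, h1, h2⟩ := h.exists_sequential hΓ hf hk
    exact ⟨fun _ => Fin n, V, fun _ => inferInstance, hV, h2.rel_subset.antisymm h1.rel_subset⟩
  tfae_have 3 → 1 := lipschitz_of_isKSequential hΓ
  tfae_finish

end Construction

end WeightedAutomaton

/-! ### Search with the word problem as an oracle -/

section OracleSearch

open Encodable

theorem Nat.RecursiveIn.comp_total {O : Set (ℕ →. ℕ)} {f g : ℕ → ℕ}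
    (hf : Nat.RecursiveIn O fun n => Part.some (f n))
    (hg : Nat.RecursiveIn O fun n => Part.some (g n)) :
    Nat.RecursiveIn O fun n => Part.some (f (g n)) :=
  (Nat.RecursiveIn.comp hf hg).of_eq fun n => by simp

theorem Nat.RecursiveIn.pair_total {O : Set (ℕ →. ℕ)} {f g : ℕ → ℕ}
    (hf : Nat.RecursiveIn O fun n => Part.some (f n))
    (hg : Nat.RecursiveIn O fun n => Part.some (g n)) :
    Nat.RecursiveIn O fun n => Part.some (Nat.pair (f n) (g n)) :=
  (Nat.RecursiveIn.pair hf hg).of_eq fun n => by simp [Seq.seq]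

theorem Nat.RecursiveIn.rec_total {O : Set (ℕ →. ℕ)} {f : ℕ → ℕ} {h : ℕ → ℕ}
    (hf : Nat.RecursiveIn O fun n => Part.some (f n))
    (hh : Nat.RecursiveIn O fun n => Part.some (h n)) :
    Nat.RecursiveIn O fun p => Part.some (Nat.rec (motive := fun _ => ℕ) (f p.unpair.1)
      (fun y i => h (Nat.pair p.unpair.1 (Nat.pair y i))) p.unpair.2) := by
  refine (Nat.RecursiveIn.prec hf hh).of_eq fun p => ?_
  simp only
  induction p.unpair.2 with
  | zero => rfl
  | succ n ih => simp only [ih]; simp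

theorem Nat.RecursiveIn.of_primrec {O : Set (ℕ →. ℕ)} {f : ℕ → ℕ} (hf : Primrec f) :
    Nat.RecursiveIn O fun n => Part.some (f n) :=
  (Primrec.nat_iff.1 hf).recursiveIn

variable {G : Type*} [Group G] {r : ℕ} {s : Fin r → G}

/-- Searching for a witness `t` of a primitive recursive relation `R a t` such that a list of words
depending on `t` consists of words that represent the neutral element is computable with the word
problem as an oracle. -/
theorem exists_recursiveIn_search (s : Fin r → G) {α σ τ : Type*} [Primcodable α] [Primcodable σ]
    [Primcodable τ] {R : α → τ → Prop} (hR : PrimrecRel R) {words : τ → List (GenWord r)}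
    (hwords : Primrec words) {out : τ → σ} (hout : Primrec out) :
    ∃ f : α →. σ, RecursiveIn {wordProblem s} f ∧
      ∀ a, (∃ t, R a t ∧ ∀ w ∈ words t, evalGenWord s w = 1) →
        ∃ t, (R a t ∧ ∀ w ∈ words t, evalGenWord s w = 1) ∧ out t ∈ f a := by
  classical
  obtain ⟨o, ho⟩ : ∃ o : ℕ → ℕ, wordProblem s = fun n => Part.some (o n) := ⟨_, rfl⟩
  have ho1 : ∀ w : GenWord r, o (encode w) = 1 ↔ evalGenWord s w = 1 := by
    intro w
    have h : Part.some (o (encode w)) = wordProblem s (encode w) := by rw [ho]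
    simp only [wordProblem, Part.some_inj] at h
    rw [h]
    constructor
    · intro h1
      by_contra hne
      rw [if_neg] at h1
      · exact absurd h1 (by simp)
      · rintro ⟨w', hw', h'⟩
        rw [encode_injective hw'] at h'
        exact hne h'
    · exact fun h1 => if_pos ⟨w, rfl, h1⟩
  have horacle : Nat.RecursiveIn {wordProblem s} fun n => Part.some (o n) := by
    rw [ho]; exact .oracle _ rfl
  -- the number of reasons for which the witness is rejected, counted up to the `n`-th word
  let base : Option (α × τ) → ℕ := fun x => x.elim 1 fun x => if R x.1 x.2 then 0 else 1
  let word : Option (α × τ) → ℕ → ℕ := fun x y =>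
    encode ((x.bind fun x => (words x.2)[y]?).getD [])
  let len : Option (α × τ) → ℕ := fun x => x.elim 0 fun x => (words x.2).length
  let rej : Option (α × τ) → ℕ := fun x =>
    Nat.rec (motive := fun _ => ℕ) (base x) (fun y i => i + (1 - o (word x y))) (len x)
  have hbase : Primrec base := by
    have : Primrec fun x : Option (α × τ) =>
        (x.map fun x => if R x.1 x.2 then (0 : ℕ) else 1).getD 1 :=
      Primrec.option_getD.comp (Primrec.option_map Primrec.id
        ((Primrec.ite (hR.comp (Primrec.fst.comp Primrec.snd) (Primrec.snd.comp Primrec.snd))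
          (Primrec.const 0) (Primrec.const 1)).to₂)) (Primrec.const 1)
    refine this.of_eq fun x => ?_
    cases x <;> rfl
  have hword : Primrec₂ word := by
    refine Primrec.encode.comp₂ (Primrec.option_getD.comp₂ (Primrec₂.mk
      (Primrec.option_bind Primrec.fst ?_)) (Primrec₂.const []))
    exact Primrec.list_getElem?.comp₂
      (hwords.comp₂ ((Primrec.snd.comp Primrec.snd).to₂)) ((Primrec.snd.comp Primrec.fst).to₂)
  have hlen : Primrec len := by
    have : Primrec fun x : Option (α × τ) => (x.map fun x => (words x.2).length).getD 0 :=
      Primrec.option_getD.comp (Primrec.option_map Primrec.id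
        ((Primrec.list_length.comp (hwords.comp (Primrec.snd.comp Primrec.snd))).to₂))
        (Primrec.const 0)
    refine this.of_eq fun x => ?_
    cases x <;> rfl
  have hrej0 : ∀ a t, rej (some (a, t)) = 0 ↔
      R a t ∧ ∀ w ∈ words t, evalGenWord s w = 1 := by
    intro a t
    have key : ∀ n ≤ (words t).length, Nat.rec (motive := fun _ => ℕ) (base (some (a, t)))
        (fun y i => i + (1 - o (word (some (a, t)) y))) n = 0 ↔
        R a t ∧ ∀ w ∈ (words t).take n, evalGenWord s w = 1 := by
      intro n
      induction n with
      | zero => intro _; by_cases h : R a t <;> simp [base, h]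
      | succ n ih =>
        intro hn
        have hw : o (word (some (a, t)) n) = o (encode (words t)[n]) := by
          simp [word, List.getElem?_eq_getElem (show n < (words t).length from hn)]
        have ho01 : 1 - o (encode (words t)[n]) = 0 ↔ evalGenWord s (words t)[n] = 1 := by
          rw [← ho1]
          have : o (encode (words t)[n]) ≤ 1 := by
            have h : Part.some (o (encode (words t)[n])) =
                wordProblem s (encode (words t)[n]) := by rw [ho]
            simp only [wordProblem, Part.some_inj] at h
            rw [h]
            split_ifs <;> omega
          omega
        simp only [Nat.add_eq_zero_iff]
        rw [ih (by omega), hw, ho01, List.take_add_one, List.getElem?_eq_getElem hn]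
        simp only [Option.toList_some, List.mem_append, List.mem_singleton]
        constructor
        · rintro ⟨⟨h1, h2⟩, h3⟩
          refine ⟨h1, ?_⟩
          rintro w (hw | rfl)
          · exact h2 w hw
          · exact h3
        · rintro ⟨h1, h2⟩
          exact ⟨⟨h1, fun w hw => h2 w (Or.inl hw)⟩, h2 _ (Or.inr rfl)⟩
    have := key _ le_rfl
    rwa [List.take_length] at this
  have hrej : Nat.RecursiveIn {wordProblem s} fun p =>
      Part.some (rej (decode (α := α × τ) p)) := by
    have hstep : Nat.RecursiveIn {wordProblem s} fun x => Part.some (x.unpair.2.unpair.2 +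
        (1 - o (word (decode (α := α × τ) x.unpair.1) x.unpair.2.unpair.1))) := by
      have h1 : Primrec fun x : ℕ =>
          word (decode (α := α × τ) x.unpair.1) x.unpair.2.unpair.1 :=
        hword.comp (Primrec.decode.comp (Primrec.fst.comp Primrec.unpair))
          (Primrec.fst.comp (Primrec.unpair.comp (Primrec.snd.comp Primrec.unpair)))
      have h2 : Primrec fun x : ℕ => x.unpair.2.unpair.2 :=
        Primrec.snd.comp (Primrec.unpair.comp (Primrec.snd.comp Primrec.unpair))
      have h3 : Primrec fun x : ℕ => x.unpair.1 + (1 - x.unpair.2) :=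
        Primrec.nat_add.comp (Primrec.fst.comp Primrec.unpair)
          (Primrec.nat_sub.comp (Primrec.const 1) (Primrec.snd.comp Primrec.unpair))
      have := (Nat.RecursiveIn.of_primrec h3).comp_total ((Nat.RecursiveIn.of_primrec h2).pair_total
        (horacle.comp_total (Nat.RecursiveIn.of_primrec h1)))
      simpa using this
    have hrec := (Nat.RecursiveIn.of_primrec (O := {wordProblem s})
      (hbase.comp (Primrec.decode (α := α × τ)))).rec_total hstep
    have := hrec.comp_total ((Nat.RecursiveIn.of_primrec Primrec.id).pair_total
      (Nat.RecursiveIn.of_primrec (hlen.comp (Primrec.decode (α := α × τ)))))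
    simpa [rej] using this
  have hdec : ∀ n n', decode (α := α × τ) (Nat.pair n n') =
      (decode (α := α) n).bind fun a => (decode (α := τ) n').map (Prod.mk a) := by
    intro n n'
    rw [decode_prod_val, Nat.unpair_pair]
  let search : ℕ →. ℕ := fun n => Nat.rfind fun n' => (fun m => m = 0) <$>
    (Part.some (rej (decode (α := α × τ) (Nat.pair n n'))) : Part ℕ)
  let res : ℕ →. ℕ := fun n' => (((decode (α := τ) n').map fun t => encode (out t) : Option ℕ))
  have hres : Nat.RecursiveIn {wordProblem s} res := by
    refine RecursiveIn.iff_nat.1 (Partrec.recursiveIn ?_)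
    exact Computable.ofOption (Primrec.option_map Primrec.decode
      ((Primrec.encode.comp (hout.comp Primrec.snd)).to₂)).to_comp
  refine ⟨fun a => (search (encode a)).bind fun n' => ((decode (α := τ) n').map out : Option σ),
    ?_, ?_⟩
  · refine (Nat.RecursiveIn.comp hres (Nat.RecursiveIn.rfind hrej)).of_eq fun n => ?_
    show (search n).bind res = _
    cases hn : decode (α := α) n with
    | none =>
      have : search n = Part.none := by
        refine Part.eq_none_iff.2 fun x hx => ?_
        have := Nat.rfind_spec hx
        simp [hdec, hn, rej, base, len] at this
      rw [this, Part.bind_none]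
      simp
    | some a =>
      have : search n = search (encode a) := by
        simp only [search, hdec, hn, encodek]
      rw [this]
      simp only [Part.coe_some, Part.bind_some, Part.map_bind]
      congr 1
      funext n'
      simp only [res]
      cases decode (α := τ) n' <;> simp
  · rintro a ⟨t, ht⟩
    have hex : true ∈ (fun n' => (fun m => decide (m = 0)) <$>
        (Part.some (rej (decode (α := α × τ) (Nat.pair (encode a) n'))) : Part ℕ)) (encode t) := by
      have := (hrej0 a t).2 ht
      simp [hdec, this]
    have hdom : (search (encode a)).Dom := by
      refine Nat.rfind_dom.2 ⟨encode t, hex, fun _ => trivial⟩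
    obtain ⟨n', hn'⟩ := Part.dom_iff_mem.1 hdom
    have hspec := Nat.rfind_spec hn'
    simp only [hdec, encodek, Option.bind_some] at hspec
    cases hd : decode (α := τ) n' with
    | none => simp [hd, rej, base, len] at hspec
    | some t' =>
      refine ⟨t', (hrej0 a t').1 (by simpa [hd] using hspec), ?_⟩
      exact Part.mem_bind hn' (by simp [hd])

end OracleSearch

/-! ### Codes and certificates -/

section Codes

variable {G : Type*} [Group G] {r : ℕ} {s : Fin r → G}

theorem evalGenWord_append (s : Fin r → G) (u v : GenWord r) :
    evalGenWord s (u ++ v) = evalGenWord s u * evalGenWord s v := by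
  rw [evalGenWord, ← FreeGroup.mul_mk, map_mul]; rfl

theorem evalGenWord_invRev (s : Fin r → G) (u : GenWord r) :
    evalGenWord s (FreeGroup.invRev u) = (evalGenWord s u)⁻¹ := by
  rw [evalGenWord, ← FreeGroup.inv_mk, map_inv]; rfl

theorem evalGenWord_surjective (hs : Subgroup.closure (Set.range s) = ⊤) :
    Function.Surjective (evalGenWord s) := by
  intro g
  have h : g ∈ (FreeGroup.lift s).range := by
    rw [FreeGroup.range_lift_eq_closure, hs]
    trivial
  obtain ⟨x, rfl⟩ := h
  obtain ⟨w, rfl⟩ := Quot.exists_rep x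
  exact ⟨w, rfl⟩

/-- Codes of automata as in `AutomatonCode`, with weights in an arbitrary type `M`. -/
abbrev RawCode (M : Type) : Type :=
  ℕ × List (ℕ × M) × List (ℕ × M) × List (ℕ × ℕ × M × ℕ)

/-- Lists of initial pairs, final pairs and transitions whose states are pairs of numbers; the state
`(i, p)` stands for the state `p` of the `i`-th automaton of a list. -/
abbrev FlatCode (M : Type) : Type :=
  List ((ℕ × ℕ) × M) × List ((ℕ × ℕ) × M) × List ((ℕ × ℕ) × ℕ × M × (ℕ × ℕ))

variable {M : Type}

/-- The initial pairs, final pairs and transitions of all automata of a list that do not mention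
states or letters out of range. -/
def flattenCodes (m : ℕ) (d : List (RawCode M)) : FlatCode M :=
  ((List.range d.length).flatMap fun i => d[i]?.toList.flatMap fun c => c.2.1.flatMap fun x =>
      if x.1 < c.1 then [((i, x.1), x.2)] else [],
    (List.range d.length).flatMap fun i => d[i]?.toList.flatMap fun c => c.2.2.1.flatMap fun x =>
      if x.1 < c.1 then [((i, x.1), x.2)] else [],
    (List.range d.length).flatMap fun i => d[i]?.toList.flatMap fun c => c.2.2.2.flatMap fun t =>
      if t.1 < c.1 ∧ t.2.1 < m ∧ t.2.2.2 < c.1 then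
        [((i, t.1), t.2.1, t.2.2.1, (i, t.2.2.2))] else [])

theorem mem_flattenCodes_init {m : ℕ} {d : List (RawCode M)} {i p : ℕ} {w : M} :
    ((i, p), w) ∈ (flattenCodes m d).1 ↔ ∃ c, d[i]? = some c ∧ p < c.1 ∧ (p, w) ∈ c.2.1 := by
  simp only [flattenCodes, List.mem_flatMap, List.mem_range, Option.mem_toList]
  constructor
  · rintro ⟨i, -, c, hc, x, hx, h⟩
    split_ifs at h with hlt
    · simp only [List.mem_singleton, Prod.mk.injEq] at h
      obtain ⟨⟨rfl, rfl⟩, rfl⟩ := h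
      exact ⟨c, hc, hlt, hx⟩
    · simp at h
  · rintro ⟨c, hc, hlt, hx⟩
    exact ⟨i, (List.getElem?_eq_some_iff.1 hc).1, c, hc, _, hx, by simp [hlt]⟩

theorem mem_flattenCodes_final {m : ℕ} {d : List (RawCode M)} {i p : ℕ} {w : M} :
    ((i, p), w) ∈ (flattenCodes m d).2.1 ↔ ∃ c, d[i]? = some c ∧ p < c.1 ∧ (p, w) ∈ c.2.2.1 := by
  simp only [flattenCodes, List.mem_flatMap, List.mem_range, Option.mem_toList]
  constructor
  · rintro ⟨i, -, c, hc, x, hx, h⟩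
    split_ifs at h with hlt
    · simp only [List.mem_singleton, Prod.mk.injEq] at h
      obtain ⟨⟨rfl, rfl⟩, rfl⟩ := h
      exact ⟨c, hc, hlt, hx⟩
    · simp at h
  · rintro ⟨c, hc, hlt, hx⟩
    exact ⟨i, (List.getElem?_eq_some_iff.1 hc).1, c, hc, _, hx, by simp [hlt]⟩

theorem mem_flattenCodes_trans {m : ℕ} {d : List (RawCode M)} {i p a j q : ℕ} {w : M} :
    ((i, p), a, w, (j, q)) ∈ (flattenCodes m d).2.2 ↔
      j = i ∧ ∃ c, d[i]? = some c ∧ p < c.1 ∧ a < m ∧ q < c.1 ∧ (p, a, w, q) ∈ c.2.2.2 := by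
  simp only [flattenCodes, List.mem_flatMap, List.mem_range, Option.mem_toList]
  constructor
  · rintro ⟨i, -, c, hc, x, hx, h⟩
    split_ifs at h with hlt
    · simp only [List.mem_singleton, Prod.mk.injEq] at h
      obtain ⟨⟨rfl, rfl⟩, rfl, rfl, rfl, rfl⟩ := h
      exact ⟨rfl, c, hc, hlt.1, hlt.2.1, hlt.2.2, hx⟩
    · simp at h
  · rintro ⟨rfl, c, hc, h1, h2, h3, hx⟩
    exact ⟨j, (List.getElem?_eq_some_iff.1 hc).1, c, hc, _, hx, by simp [h1, h2, h3]⟩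

/-- The flat code `F` describes the automaton `V`, whose states are represented by pairs of numbers
according to `enc`. -/
structure Describes {m : ℕ} {P : Type*} (s : Fin r → G) (F : FlatCode (GenWord r))
    (V : WeightedAutomaton (Fin m) P G) (enc : P → ℕ × ℕ) : Prop where
  injective : Function.Injective enc
  init : ∀ p g, (p, g) ∈ V.init ↔ ∃ w, (enc p, w) ∈ F.1 ∧ g = evalGenWord s w
  init_enc : ∀ x ∈ F.1, ∃ p, x.1 = enc p
  final : ∀ p g, (p, g) ∈ V.final ↔ ∃ w, (enc p, w) ∈ F.2.1 ∧ g = evalGenWord s w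
  final_enc : ∀ x ∈ F.2.1, ∃ p, x.1 = enc p
  trans : ∀ p a g q, (p, a, g, q) ∈ V.trans ↔
    ∃ w, (enc p, (a : ℕ), w, enc q) ∈ F.2.2 ∧ g = evalGenWord s w
  trans_enc : ∀ t ∈ F.2.2, ∃ p, ∃ a : Fin m, ∃ q, t.1 = enc p ∧ t.2.1 = a ∧ t.2.2.2 = enc q

theorem describes_toAutomaton (s : Fin r → G) (m : ℕ) (c : AutomatonCode r) :
    Describes s (flattenCodes m [c]) (c.toAutomaton s m) fun p => (0, (p : ℕ)) where
  injective p q h := Fin.ext (Prod.mk.inj h).2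
  init p g := by simp [mem_flattenCodes_init, AutomatonCode.toAutomaton]
  init_enc := by
    rintro ⟨⟨i, p⟩, w⟩ hx
    obtain ⟨c', hc, hp, -⟩ := mem_flattenCodes_init.1 hx
    obtain ⟨hi, rfl⟩ := List.getElem?_eq_some_iff.1 hc
    obtain rfl : i = 0 := by simpa using hi
    exact ⟨⟨p, hp⟩, rfl⟩
  final p g := by simp [mem_flattenCodes_final, AutomatonCode.toAutomaton]
  final_enc := by
    rintro ⟨⟨i, p⟩, w⟩ hx
    obtain ⟨c', hc, hp, -⟩ := mem_flattenCodes_final.1 hx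
    obtain ⟨hi, rfl⟩ := List.getElem?_eq_some_iff.1 hc
    obtain rfl : i = 0 := by simpa using hi
    exact ⟨⟨p, hp⟩, rfl⟩
  trans p a g q := by simp [mem_flattenCodes_trans, AutomatonCode.toAutomaton]
  trans_enc := by
    rintro ⟨⟨i, p⟩, a, w, ⟨j, q⟩⟩ hx
    obtain ⟨rfl, c', hc, hp, ha, hq, -⟩ := mem_flattenCodes_trans.1 hx
    obtain ⟨hi, rfl⟩ := List.getElem?_eq_some_iff.1 hc
    obtain rfl : j = 0 := by simpa using hi
    exact ⟨⟨p, hp⟩, ⟨a, ha⟩, ⟨q, hq⟩, rfl, rfl, rfl⟩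

/-- The flat code of a list describes the union of the automata that the list describes. -/
theorem describes_union {m k : ℕ} {d : List (AutomatonCode r)} {n : Fin k → ℕ}
    {V : ∀ i, WeightedAutomaton (Fin m) (Fin (n i)) G} (hk : d.length = k)
    (hd : ∀ i : Fin k, ∃ c l l' l'', d[(i : ℕ)]? = some c ∧ c = (n i, l, l', l'') ∧
      AutomatonCode.toAutomaton s m (n i, l, l', l'') = V i) :
    Describes s (flattenCodes m d) (WeightedAutomaton.union V) fun p => ((p.1 : ℕ), (p.2 : ℕ)) where
  injective := by
    rintro ⟨i, p⟩ ⟨j, q⟩ h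
    simp only [Prod.mk.injEq] at h
    obtain rfl := Fin.ext h.1
    obtain rfl := Fin.ext h.2
    rfl
  init := by
    rintro ⟨i, p⟩ g
    obtain ⟨c, l, l', l'', hc, rfl, hV⟩ := hd i
    rw [WeightedAutomaton.mem_union_init]
    simp only
    rw [← hV]
    simp [mem_flattenCodes_init, AutomatonCode.toAutomaton, hc]
  init_enc := by
    rintro ⟨⟨i, p⟩, w⟩ hx
    obtain ⟨c', hc, hp, -⟩ := mem_flattenCodes_init.1 hx
    obtain ⟨hi, -⟩ := List.getElem?_eq_some_iff.1 hc
    obtain ⟨c, l, l', l'', hc', rfl, hV⟩ := hd ⟨i, hk ▸ hi⟩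
    obtain rfl := Option.some.inj (hc.symm.trans hc')
    exact ⟨⟨⟨i, hk ▸ hi⟩, ⟨p, hp⟩⟩, rfl⟩
  final := by
    rintro ⟨i, p⟩ g
    obtain ⟨c, l, l', l'', hc, rfl, hV⟩ := hd i
    rw [WeightedAutomaton.mem_union_final]
    simp only
    rw [← hV]
    simp [mem_flattenCodes_final, AutomatonCode.toAutomaton, hc]
  final_enc := by
    rintro ⟨⟨i, p⟩, w⟩ hx
    obtain ⟨c', hc, hp, -⟩ := mem_flattenCodes_final.1 hx
    obtain ⟨hi, -⟩ := List.getElem?_eq_some_iff.1 hc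
    obtain ⟨c, l, l', l'', hc', rfl, hV⟩ := hd ⟨i, hk ▸ hi⟩
    obtain rfl := Option.some.inj (hc.symm.trans hc')
    exact ⟨⟨⟨i, hk ▸ hi⟩, ⟨p, hp⟩⟩, rfl⟩
  trans := by
    rintro ⟨i, p⟩ a g ⟨j, q⟩
    obtain ⟨c, l, l', l'', hc, rfl, hV⟩ := hd i
    rw [WeightedAutomaton.mem_union_trans]
    constructor
    · rintro ⟨i', p', q', h1, h2, h⟩
      obtain ⟨rfl, h1⟩ := Sigma.mk.inj h1
      obtain ⟨rfl, h2⟩ := Sigma.mk.inj h2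
      obtain rfl := eq_of_heq h1
      obtain rfl := eq_of_heq h2
      rw [← hV] at h
      obtain ⟨w, hw, hg⟩ := h
      exact ⟨w, mem_flattenCodes_trans.2 ⟨rfl, _, hc, p.2, a.2, q.2, hw⟩, hg⟩
    · rintro ⟨w, hw, hg⟩
      obtain ⟨hij, c, hc', h1, h2, h3, h4⟩ := mem_flattenCodes_trans.1 hw
      obtain rfl := Fin.ext hij
      obtain rfl := Option.some.inj (hc.symm.trans hc')
      exact ⟨_, p, q, rfl, rfl, by rw [← hV]; exact ⟨w, h4, hg⟩⟩
  trans_enc := by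
    rintro ⟨⟨i, p⟩, a, w, ⟨j, q⟩⟩ hx
    obtain ⟨rfl, c', hc, hp, ha, hq, -⟩ := mem_flattenCodes_trans.1 hx
    obtain ⟨hi, -⟩ := List.getElem?_eq_some_iff.1 hc
    obtain ⟨c, l, l', l'', hc', rfl, hV⟩ := hd ⟨j, hk ▸ hi⟩
    obtain rfl := Option.some.inj (hc.symm.trans hc')
    exact ⟨⟨⟨j, hk ▸ hi⟩, ⟨p, hp⟩⟩, ⟨a, ha⟩, ⟨⟨j, hk ▸ hi⟩, ⟨q, hq⟩⟩, rfl, rfl, rfl⟩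

/-- The closure properties of a simulation, for flat codes `F` and `E` and a list `B` that represents
the simulation. Equality in the group is replaced by membership in a list `T` of pairs of words, so
that the condition is primitive recursive. -/
def IsSimulationCode [Append M] (F E : FlatCode M) (B : List ((ℕ × ℕ) × List ((ℕ × ℕ) × M)))
    (T : List (M × M)) : Prop :=
  (∀ x ∈ F.1, ∃ b ∈ B, b.1 = x.1 ∧ ∀ y ∈ b.2, ∃ z ∈ E.1, z.1 = y.1 ∧
    ∃ e ∈ T, e = (z.2, x.2 ++ y.2)) ∧
  (∀ b ∈ B, ∀ t ∈ F.2.2, t.1 = b.1 → ∃ b' ∈ B, b'.1 = t.2.2.2 ∧ ∀ y' ∈ b'.2, ∃ y ∈ b.2,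
    ∃ t' ∈ E.2.2, t'.1 = y.1 ∧ t'.2.1 = t.2.1 ∧ t'.2.2.2 = y'.1 ∧
      ∃ e ∈ T, e = (y.2 ++ t'.2.2.1, t.2.2.1 ++ y'.2)) ∧
  ∀ b ∈ B, ∀ x ∈ F.2.1, x.1 = b.1 → ∃ y ∈ b.2, ∃ z ∈ E.2.1, z.1 = y.1 ∧
    ∃ e ∈ T, e = (y.2 ++ z.2, x.2)

theorem IsSimulationCode.isSimulation {m : ℕ} {P P' : Type*}
    {V : WeightedAutomaton (Fin m) P G} {U : WeightedAutomaton (Fin m) P' G} {F E : FlatCode (GenWord r)}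
    {enc : P → ℕ × ℕ} {enc' : P' → ℕ × ℕ} (hF : Describes s F V enc) (hE : Describes s E U enc')
    {B : List ((ℕ × ℕ) × List ((ℕ × ℕ) × GenWord r))} {T : List (GenWord r × GenWord r)}
    (hT : ∀ e ∈ T, evalGenWord s e.1 = evalGenWord s e.2) (h : IsSimulationCode F E B T) :
    WeightedAutomaton.IsSimulation V U {b | ∃ b' ∈ B, b'.1 = enc b.1 ∧
      b.2 = {y | ∃ w, (enc' y.1, w) ∈ b'.2 ∧ y.2 = evalGenWord s w}} := by
  obtain ⟨hi, ht, hf⟩ := h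
  refine ⟨fun q α hq => ?_, ?_, ?_⟩
  · obtain ⟨w, hw, rfl⟩ := (hF.init q α).1 hq
    obtain ⟨b, hb, hbq, hback⟩ := hi _ hw
    refine ⟨_, ⟨b, hb, hbq, rfl⟩, ?_⟩
    rintro p _ ⟨v, hv, rfl⟩
    obtain ⟨⟨p', z⟩, hz, h1, e, he, rfl⟩ := hback _ hv
    simp only at h1
    subst h1
    have := hT _ he
    rw [evalGenWord_append] at this
    exact (hE.init p _).2 ⟨z, hz, this.symm⟩
  · rintro q _ a α q' ⟨b, hb, hbq, rfl⟩ htr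
    obtain ⟨w, hw, rfl⟩ := (hF.trans q a α q').1 htr
    obtain ⟨b', hb', hbq', hback⟩ := ht b hb _ hw hbq.symm
    refine ⟨_, ⟨b', hb', hbq', rfl⟩, ?_⟩
    rintro p' _ ⟨v', hv', rfl⟩
    obtain ⟨⟨p₁, v⟩, hv, ⟨p₂, a₂, w₂, q₂⟩, htr₂, h1, h2, h3, e, he, rfl⟩ := hback _ hv'
    simp only at h1 h2 h3
    subst h1 h2 h3
    obtain ⟨p, a', q, h1, h2, h3⟩ := hE.trans_enc _ htr₂
    simp only at h1 h2 h3
    have := hT _ he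
    simp only [evalGenWord_append] at this
    refine ⟨p, evalGenWord s v, evalGenWord s w₂, ⟨v, by rwa [← h1], rfl⟩,
      (hE.trans _ _ _ _).2 ⟨w₂, by rwa [← h1], rfl⟩, this⟩
  · rintro q _ γ ⟨b, hb, hbq, rfl⟩ hγ
    obtain ⟨w, hw, rfl⟩ := (hF.final q γ).1 hγ
    obtain ⟨⟨p₁, v⟩, hv, ⟨p₂, z⟩, hz, h1, e, he, rfl⟩ := hf b hb _ hw hbq.symm
    simp only at h1
    subst h1
    obtain ⟨p, h1⟩ := hE.final_enc _ hz
    simp only at h1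
    have := hT _ he
    simp only [evalGenWord_append] at this
    exact ⟨p, evalGenWord s v, evalGenWord s z, ⟨v, by rwa [← h1], rfl⟩,
      (hE.final _ _).2 ⟨z, by rwa [← h1], rfl⟩, this⟩

/-- A finite list of pairs of words that contains all valid equations between products of two words
from a given list. -/
theorem exists_equations (s : Fin r → G) (L : List (GenWord r)) :
    ∃ T : List (GenWord r × GenWord r), (∀ e ∈ T, evalGenWord s e.1 = evalGenWord s e.2) ∧
      ∀ u ∈ L, ∀ v ∈ L, ∀ u' ∈ L, ∀ v' ∈ L, evalGenWord s (u ++ v) = evalGenWord s (u' ++ v') →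
        ∃ e ∈ T, e = (u ++ v, u' ++ v') := by
  have hfin : {e : GenWord r × GenWord r | evalGenWord s e.1 = evalGenWord s e.2 ∧
      ∃ x ∈ (L ×ˢ L) ×ˢ (L ×ˢ L), e = (x.1.1 ++ x.1.2, x.2.1 ++ x.2.2)}.Finite := by
    refine ((List.finite_toSet ((L ×ˢ L) ×ˢ (L ×ˢ L))).image
      fun x => (x.1.1 ++ x.1.2, x.2.1 ++ x.2.2)).subset ?_
    rintro _ ⟨-, x, hx, rfl⟩
    exact ⟨x, hx, rfl⟩
  refine ⟨hfin.toFinset.toList, fun e he => ?_, fun u hu v hv u' hu' v' hv' he => ⟨_, ?_, rfl⟩⟩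
  · rw [Finset.mem_toList, Set.Finite.mem_toFinset] at he
    exact he.1
  · rw [Finset.mem_toList, Set.Finite.mem_toFinset]
    exact ⟨he, ((u, v), (u', v')), by simp [hu, hv, hu', hv'], rfl⟩

theorem exists_isSimulationCode (hs : Subgroup.closure (Set.range s) = ⊤) {m : ℕ} {P P' : Type*}
    {V : WeightedAutomaton (Fin m) P G} {U : WeightedAutomaton (Fin m) P' G} {F E : FlatCode (GenWord r)}
    {enc : P → ℕ × ℕ} {enc' : P' → ℕ × ℕ} (hF : Describes s F V enc) (hE : Describes s E U enc')
    (h : WeightedAutomaton.Simulates V U) :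
    ∃ B T, (∀ e ∈ T, evalGenWord s e.1 = evalGenWord s e.2) ∧ IsSimulationCode F E B T := by
  obtain ⟨B, hB, hBf, hi, ht, hf⟩ := h
  choose σ hσ using evalGenWord_surjective hs
  have hlist : ∀ b ∈ B, ∃ l : List ((ℕ × ℕ) × GenWord r),
      ∀ x, x ∈ l ↔ ∃ y ∈ b.2, (enc' y.1, σ y.2) = x := by
    intro b hb
    refine ⟨((hBf b hb).image fun y => (enc' y.1, σ y.2)).toFinset.toList, fun x => ?_⟩
    rw [Finset.mem_toList, Set.Finite.mem_toFinset]
    rfl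
  choose! l hl using hlist
  obtain ⟨B', hB'⟩ : ∃ B' : List ((ℕ × ℕ) × List ((ℕ × ℕ) × GenWord r)),
      ∀ x, x ∈ B' ↔ ∃ b ∈ B, (enc b.1, l b) = x := by
    refine ⟨(hB.image fun b => (enc b.1, l b)).toFinset.toList, fun x => ?_⟩
    rw [Finset.mem_toList, Set.Finite.mem_toFinset]
    rfl
  set L : List (GenWord r) := [] :: (F.1.map Prod.snd ++ (F.2.1.map Prod.snd ++
    (F.2.2.map (fun t => t.2.2.1) ++ (E.1.map Prod.snd ++ (E.2.1.map Prod.snd ++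
    (E.2.2.map (fun t => t.2.2.1) ++ B'.flatMap fun b => b.2.map Prod.snd)))))) with hL
  have hL0 : [] ∈ L := by simp [hL]
  have hLF1 : ∀ x ∈ F.1, x.2 ∈ L := fun x hx => by
    have := List.mem_map_of_mem (f := Prod.snd) hx
    simp only [hL, List.mem_cons, List.mem_append]; tauto
  have hLF2 : ∀ x ∈ F.2.1, x.2 ∈ L := fun x hx => by
    have := List.mem_map_of_mem (f := Prod.snd) hx
    simp only [hL, List.mem_cons, List.mem_append]; tauto
  have hLF3 : ∀ x ∈ F.2.2, x.2.2.1 ∈ L := fun x hx => by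
    have := List.mem_map_of_mem (f := fun t => t.2.2.1) hx
    simp only [hL, List.mem_cons, List.mem_append]; tauto
  have hLE1 : ∀ x ∈ E.1, x.2 ∈ L := fun x hx => by
    have := List.mem_map_of_mem (f := Prod.snd) hx
    simp only [hL, List.mem_cons, List.mem_append]; tauto
  have hLE2 : ∀ x ∈ E.2.1, x.2 ∈ L := fun x hx => by
    have := List.mem_map_of_mem (f := Prod.snd) hx
    simp only [hL, List.mem_cons, List.mem_append]; tauto
  have hLE3 : ∀ x ∈ E.2.2, x.2.2.1 ∈ L := fun x hx => by
    have := List.mem_map_of_mem (f := fun t => t.2.2.1) hx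
    simp only [hL, List.mem_cons, List.mem_append]; tauto
  have hLB : ∀ b ∈ B', ∀ y ∈ b.2, y.2 ∈ L := fun b hb y hy => by
    have := List.mem_flatMap (f := fun b => b.2.map Prod.snd).2 ⟨b, hb, List.mem_map_of_mem (f := Prod.snd) hy⟩
    simp only [hL, List.mem_cons, List.mem_append]; tauto
  obtain ⟨T, hT, hTL⟩ := exists_equations s L
  refine ⟨B', T, hT, ?_, ?_, ?_⟩
  · rintro ⟨x, w⟩ hx
    obtain ⟨q, hq⟩ := hF.init_enc _ hx
    simp only at hq
    subst hq
    obtain ⟨Y, hY, hback⟩ := hi q _ ((hF.init q _).2 ⟨w, hx, rfl⟩)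
    have hbB := (hB' (enc q, l (q, Y))).2 ⟨(q, Y), hY, rfl⟩
    refine ⟨_, hbB, rfl, fun y hy => ?_⟩
    obtain ⟨⟨p, g⟩, hpg, rfl⟩ := (hl _ hY y).1 hy
    obtain ⟨z, hz, hzg⟩ := (hE.init p _).1 (hback p g hpg)
    refine ⟨_, hz, rfl, ?_⟩
    have := hTL z (hLE1 _ hz) [] hL0 w (hLF1 _ hx) (σ g) (hLB _ hbB _ hy) (by
      rw [List.append_nil, evalGenWord_append, hσ, ← hzg])
    rwa [List.append_nil] at this
  · rintro b hb ⟨t1, a₀, w, t2⟩ ht' htb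
    obtain ⟨⟨q, Y⟩, hY, rfl⟩ := (hB' b).1 hb
    obtain ⟨q₁, a, q', h1, h2, h3⟩ := hF.trans_enc _ ht'
    simp only at h1 h2 h3 htb
    subst h1 h2 h3
    obtain rfl := hF.injective htb
    obtain ⟨Y', hY', hback⟩ := ht _ Y a _ q' hY ((hF.trans _ a _ q').2 ⟨w, ht', rfl⟩)
    have hbB := (hB' (enc q', l (q', Y'))).2 ⟨(q', Y'), hY', rfl⟩
    refine ⟨_, hbB, rfl, fun y' hy' => ?_⟩
    obtain ⟨⟨p', g'⟩, hpg', rfl⟩ := (hl _ hY' y').1 hy'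
    obtain ⟨p, g, η, hpg, htr, heq⟩ := hback p' g' hpg'
    obtain ⟨v, hv, rfl⟩ := (hE.trans p a η p').1 htr
    have hy := (hl _ hY (enc' p, σ g)).2 ⟨(p, g), hpg, rfl⟩
    refine ⟨_, hy, _, hv, rfl, rfl, rfl, ?_⟩
    exact hTL _ (hLB _ hb _ hy) _ (hLE3 _ hv) _ (hLF3 _ ht') _ (hLB _ hbB _ hy') (by
      simp only [evalGenWord_append, hσ]; exact heq)
  · rintro b hb ⟨x, w⟩ hx hxb
    obtain ⟨⟨q, Y⟩, hY, rfl⟩ := (hB' b).1 hb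
    simp only at hxb
    subst hxb
    obtain ⟨p, g, η, hpg, hη, heq⟩ := hf q Y _ hY ((hF.final q _).2 ⟨w, hx, rfl⟩)
    obtain ⟨z, hz, rfl⟩ := (hE.final p η).1 hη
    have hy := (hl _ hY (enc' p, σ g)).2 ⟨(p, g), hpg, rfl⟩
    refine ⟨_, hy, _, hz, rfl, ?_⟩
    have := hTL _ (hLB _ hb _ hy) _ (hLE2 _ hz) _ (hLF2 _ hx) [] hL0 (by
      simp only [evalGenWord_append, hσ, List.append_nil]; exact heq)
    rwa [List.append_nil] at this

/-- A syntactic condition on codes that guarantees that the described automaton is sequential. -/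
def IsSequentialCode (c : RawCode M) : Prop :=
  c.2.1.length = 1 ∧ (∀ x ∈ c.2.1, x.1 < c.1) ∧
    ∀ t ∈ c.2.2.2, ∀ t' ∈ c.2.2.2, t.1 = t'.1 → t.2.1 = t'.2.1 → t = t'

theorem IsSequentialCode.isSequential {m : ℕ} {c : AutomatonCode r} (h : IsSequentialCode c) :
    (c.toAutomaton s m).IsSequential := by
  obtain ⟨h1, h2, h3⟩ := h
  obtain ⟨⟨p, w⟩, hx⟩ := List.length_eq_one_iff.1 h1
  have hp : p < c.1 := h2 (p, w) (by simp [hx])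
  refine ⟨⟨(⟨p, hp⟩, evalGenWord s w), ?_⟩, ?_⟩
  · ext ⟨q, g⟩
    constructor
    · rintro ⟨v, hv, hg⟩
      simp only [hx, List.mem_singleton, Prod.mk.injEq] at hv
      obtain ⟨hq, rfl⟩ := hv
      exact Prod.ext (Fin.ext hq) hg
    · intro h
      rw [Set.mem_singleton_iff, Prod.mk.injEq] at h
      obtain ⟨rfl, rfl⟩ := h
      exact ⟨w, by simp [hx], rfl⟩
  · rintro p a α q α' q' ⟨w, hw, rfl⟩ ⟨w', hw', rfl⟩
    have := h3 _ hw _ hw' rfl rfl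
    simp only [Prod.mk.injEq, true_and] at this
    exact ⟨by simp only [this.1], Fin.ext this.2⟩

/-- Every sequential automaton with numbered letters and states has a code. -/
theorem exists_isSequentialCode (hs : Subgroup.closure (Set.range s) = ⊤) {m n : ℕ}
    {V : WeightedAutomaton (Fin m) (Fin n) G} (hV : V.IsSequential) :
    ∃ l l' l'', IsSequentialCode ((n, l, l', l'') : AutomatonCode r) ∧
      AutomatonCode.toAutomaton s m (n, l, l', l'') = V := by
  choose σ hσ using evalGenWord_surjective hs
  obtain ⟨⟨p₀, g₀⟩, hp₀⟩ := hV.1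
  obtain ⟨l', hl'⟩ : ∃ l' : List (ℕ × GenWord r),
      ∀ x, x ∈ l' ↔ ∃ y ∈ V.final, ((y.1 : ℕ), σ y.2) = x := by
    refine ⟨(V.final_finite.image fun y => ((y.1 : ℕ), σ y.2)).toFinset.toList, fun x => ?_⟩
    rw [Finset.mem_toList, Set.Finite.mem_toFinset]
    rfl
  obtain ⟨l'', hl''⟩ : ∃ l'' : List (ℕ × ℕ × GenWord r × ℕ),
      ∀ x, x ∈ l'' ↔ ∃ t ∈ V.trans, ((t.1 : ℕ), (t.2.1 : ℕ), σ t.2.2.1, (t.2.2.2 : ℕ)) = x := by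
    refine ⟨(V.trans_finite.image fun t =>
      ((t.1 : ℕ), (t.2.1 : ℕ), σ t.2.2.1, (t.2.2.2 : ℕ))).toFinset.toList, fun x => ?_⟩
    rw [Finset.mem_toList, Set.Finite.mem_toFinset]
    rfl
  refine ⟨[((p₀ : ℕ), σ g₀)], l', l'', ⟨rfl, by simp, ?_⟩, ?_⟩
  · intro t ht t' ht' h1 h2
    obtain ⟨⟨p, a, g, q⟩, hT, rfl⟩ := (hl'' t).1 ht
    obtain ⟨⟨p', a', g', q'⟩, hT', rfl⟩ := (hl'' t').1 ht'
    simp only at h1 h2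
    obtain rfl := Fin.ext h1
    obtain rfl := Fin.ext h2
    obtain ⟨rfl, rfl⟩ := hV.2 _ _ _ _ _ _ hT hT'
    rfl
  · have hi : {x : Fin n × G | ∃ w, ((x.1 : ℕ), w) ∈ [((p₀ : ℕ), σ g₀)] ∧
        x.2 = evalGenWord s w} = V.init := by
      rw [hp₀]
      ext ⟨p, g⟩
      constructor
      · rintro ⟨w, hw, hg⟩
        simp only [List.mem_singleton, Prod.mk.injEq] at hw
        obtain ⟨h1, rfl⟩ := hw
        rw [hσ] at hg
        exact Prod.ext (Fin.ext h1) hg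
      · intro h
        rw [Set.mem_singleton_iff, Prod.mk.injEq] at h
        obtain ⟨rfl, rfl⟩ := h
        exact ⟨σ g, by simp, (hσ g).symm⟩
    have hf : {x : Fin n × G | ∃ w, ((x.1 : ℕ), w) ∈ l' ∧ x.2 = evalGenWord s w} = V.final := by
      ext ⟨p, g⟩
      constructor
      · rintro ⟨w, hw, hg⟩
        obtain ⟨⟨p', g'⟩, hy, he⟩ := (hl' _).1 hw
        simp only [Prod.mk.injEq] at he
        obtain ⟨h1, rfl⟩ := he
        obtain rfl := Fin.ext h1
        simp only [hσ] at hg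
        rwa [hg]
      · exact fun h => ⟨σ g, (hl' _).2 ⟨_, h, rfl⟩, (hσ g).symm⟩
    have ht : {t : Fin n × Fin m × G × Fin n | ∃ w,
        ((t.1 : ℕ), (t.2.1 : ℕ), w, (t.2.2.2 : ℕ)) ∈ l'' ∧ t.2.2.1 = evalGenWord s w} =
          V.trans := by
      ext ⟨p, a, g, q⟩
      constructor
      · rintro ⟨w, hw, hg⟩
        obtain ⟨⟨p', a', g', q'⟩, hy, he⟩ := (hl'' _).1 hw
        simp only [Prod.mk.injEq] at he
        obtain ⟨h1, h2, rfl, h4⟩ := he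
        obtain rfl := Fin.ext h1
        obtain rfl := Fin.ext h2
        obtain rfl := Fin.ext h4
        simp only [hσ] at hg
        rwa [hg]
      · exact fun h => ⟨σ g, (hl'' _).2 ⟨_, h, rfl⟩, (hσ g).symm⟩
    cases V
    simp only [AutomatonCode.toAutomaton, WeightedAutomaton.mk.injEq]
    exact ⟨hi, hf, ht⟩

end Codes

/-! ### The algorithm -/

section Algorithm

theorem primrec_self {α : Type*} [Primcodable α] : Primrec fun a : α => a := Primrec.id

theorem PrimrecPred.ball {α β : Type*} [Primcodable α] [Primcodable β] {f : α → List β}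
    {p : α → β → Prop} (hf : Primrec f) (hp : PrimrecPred fun x : α × β => p x.1 x.2) :
    PrimrecPred fun a => ∀ b ∈ f a, p a b :=
  (PrimrecRel.forall_mem_list (R := fun b a => p a b)
    (hp.comp (Primrec.snd.pair Primrec.fst))).comp hf Primrec.id

theorem PrimrecPred.bex {α β : Type*} [Primcodable α] [Primcodable β] {f : α → List β}
    {p : α → β → Prop} (hf : Primrec f) (hp : PrimrecPred fun x : α × β => p x.1 x.2) :
    PrimrecPred fun a => ∃ b ∈ f a, p a b :=
  (PrimrecRel.exists_mem_list (R := fun b a => p a b)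
    (hp.comp (Primrec.snd.pair Primrec.fst))).comp hf Primrec.id

theorem PrimrecPred.imp {α : Type*} [Primcodable α] {p q : α → Prop} (hp : PrimrecPred p)
    (hq : PrimrecPred q) : PrimrecPred fun a => p a → q a :=
  (hp.not.or hq).of_eq fun _ => imp_iff_not_or.symm

variable {M : Type} [Primcodable M]

theorem primrec_flattenCodes :
    Primrec₂ fun (m : ℕ) (d : List (RawCode M)) => flattenCodes m d := by
  refine Primrec₂.mk ?_
  have h1 : Primrec fun x : ℕ × List (RawCode M) => List.range x.2.length :=
    Primrec.list_range.comp (Primrec.list_length.comp Primrec.snd)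
  have h2 : Primrec fun x : (ℕ × List (RawCode M)) × ℕ => (x.1.2[x.2]?).toList :=
    Primrec.optionToList.comp (Primrec.list_getElem?.comp (Primrec.snd.comp Primrec.fst)
      Primrec.snd)
  have h3 : Primrec fun x : (((ℕ × List (RawCode M)) × ℕ) × RawCode M) ×
      (ℕ × M) => if x.2.1 < x.1.2.1 then [((x.1.1.2, x.2.1), x.2.2)] else [] := by
    refine Primrec.ite (Primrec.nat_lt.comp ?_ ?_) (Primrec.list_cons.comp
      (Primrec.pair (Primrec.pair ?_ ?_) ?_) (Primrec.const [])) (Primrec.const [])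
    all_goals
      repeat first
        | with_reducible exact primrec_self
        | with_reducible refine Primrec.fst.comp ?_
        | with_reducible refine Primrec.snd.comp ?_
  have h4 : Primrec fun x : (((ℕ × List (RawCode M)) × ℕ) × RawCode M) ×
      (ℕ × ℕ × M × ℕ) =>
      if x.2.1 < x.1.2.1 ∧ x.2.2.1 < x.1.1.1.1 ∧ x.2.2.2.2 < x.1.2.1 then
        [((x.1.1.2, x.2.1), x.2.2.1, x.2.2.2.1, (x.1.1.2, x.2.2.2.2))] else [] := by
    refine Primrec.ite ((Primrec.nat_lt.comp ?_ ?_).and ((Primrec.nat_lt.comp ?_ ?_).and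
      (Primrec.nat_lt.comp ?_ ?_))) (Primrec.list_cons.comp
      (Primrec.pair (Primrec.pair ?_ ?_) (Primrec.pair ?_ (Primrec.pair ?_
        (Primrec.pair ?_ ?_)))) (Primrec.const [])) (Primrec.const [])
    all_goals
      repeat first
        | with_reducible exact primrec_self
        | with_reducible refine Primrec.fst.comp ?_
        | with_reducible refine Primrec.snd.comp ?_
  refine Primrec.pair ?_ (Primrec.pair ?_ ?_)
  · exact Primrec.list_flatMap h1 (Primrec.list_flatMap h2 (Primrec.list_flatMap
      (Primrec.fst.comp (Primrec.snd.comp Primrec.snd)) h3.to₂).to₂).to₂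
  · exact Primrec.list_flatMap h1 (Primrec.list_flatMap h2 (Primrec.list_flatMap
      (Primrec.fst.comp (Primrec.snd.comp (Primrec.snd.comp Primrec.snd))) h3.to₂).to₂).to₂
  · exact Primrec.list_flatMap h1 (Primrec.list_flatMap h2 (Primrec.list_flatMap
      (Primrec.snd.comp (Primrec.snd.comp (Primrec.snd.comp Primrec.snd))) h4.to₂).to₂).to₂

set_option synthInstance.maxSize 1024 in
theorem primrecPred_isSimulationCode [Append M]
    (happ : Primrec₂ fun u v : M => u ++ v) :
    PrimrecPred fun x : (FlatCode M × FlatCode M) ×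
      List ((ℕ × ℕ) × List ((ℕ × ℕ) × M)) × List (M × M) =>
        IsSimulationCode x.1.1 x.1.2 x.2.1 x.2.2 := by
  refine PrimrecPred.and ?_ (PrimrecPred.and ?_ ?_)
  · refine .ball ?_ (.bex ?_ (.and (Primrec.eq.comp ?_ ?_) (.ball ?_ (.bex ?_
      (.and (Primrec.eq.comp ?_ ?_) (.bex ?_ (Primrec.eq.comp ?_ (Primrec.pair ?_
        (happ.comp ?_ ?_)))))))))
    all_goals
      repeat first
        | with_reducible exact primrec_self
        | with_reducible refine Primrec.fst.comp ?_
        | with_reducible refine Primrec.snd.comp ?_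
  · refine .ball ?_ (.ball ?_ (.imp (Primrec.eq.comp ?_ ?_) (.bex ?_ (.and
      (Primrec.eq.comp ?_ ?_) (.ball ?_ (.bex ?_ (.bex ?_ (.and (Primrec.eq.comp ?_ ?_) (.and
        (Primrec.eq.comp ?_ ?_) (.and (Primrec.eq.comp ?_ ?_) (.bex ?_ (Primrec.eq.comp ?_
          (Primrec.pair (happ.comp ?_ ?_) (happ.comp ?_ ?_))))))))))))))
    all_goals
      repeat first
        | with_reducible exact primrec_self
        | with_reducible refine Primrec.fst.comp ?_
        | with_reducible refine Primrec.snd.comp ?_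
  · refine .ball ?_ (.ball ?_ (.imp (Primrec.eq.comp ?_ ?_) (.bex ?_ (.bex ?_ (.and
      (Primrec.eq.comp ?_ ?_) (.bex ?_ (Primrec.eq.comp ?_ (Primrec.pair
        (happ.comp ?_ ?_) ?_))))))))
    all_goals
      repeat first
        | with_reducible exact primrec_self
        | with_reducible refine Primrec.fst.comp ?_
        | with_reducible refine Primrec.snd.comp ?_

theorem primrecPred_isSequentialCode : PrimrecPred (IsSequentialCode (M := M)) := by
  refine PrimrecPred.and (Primrec.eq.comp (Primrec.list_length.comp ?_) (Primrec.const 1))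
    (.and (.ball ?_ (Primrec.nat_lt.comp ?_ ?_)) (.ball ?_ (.ball ?_ (.imp
      (Primrec.eq.comp ?_ ?_) (.imp (Primrec.eq.comp ?_ ?_) (Primrec.eq.comp ?_ ?_))))))
  all_goals
    repeat first
      | with_reducible exact primrec_self
      | with_reducible refine Primrec.fst.comp ?_
      | with_reducible refine Primrec.snd.comp ?_

/-- A candidate for the output of the algorithm, together with the data that certify its
correctness: a list of codes, representations of simulations in both directions, and the pairs of
words whose equality in the group these simulations rely on. -/
abbrev Certificate (M : Type) : Type :=
  List (RawCode M) × List ((ℕ × ℕ) × List ((ℕ × ℕ) × M)) ×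
    List ((ℕ × ℕ) × List ((ℕ × ℕ) × M)) × List (M × M)

/-- The certificate `t` consists of `k` sequential automata whose union is equivalent to the
automaton with code `c`, provided that the equations listed in `t` hold. Here `x = (m, k, c)`. -/
def IsCertificate [Append M] (x : ℕ × ℕ × RawCode M) (t : Certificate M) : Prop :=
  t.1.length = x.2.1 ∧ (∀ e ∈ t.1, IsSequentialCode e) ∧
    IsSimulationCode (flattenCodes x.1 [x.2.2]) (flattenCodes x.1 t.1) t.2.1 t.2.2.2 ∧
    IsSimulationCode (flattenCodes x.1 t.1) (flattenCodes x.1 [x.2.2]) t.2.2.1 t.2.2.2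

theorem primrecRel_isCertificate [Append M] (happ : Primrec₂ fun u v : M => u ++ v) :
    PrimrecRel (IsCertificate (M := M)) := by
  have h1 : Primrec fun y : (ℕ × ℕ × RawCode M) × Certificate M =>
      flattenCodes y.1.1 [y.1.2.2] :=
    primrec_flattenCodes.comp (Primrec.fst.comp Primrec.fst)
      (Primrec.list_cons.comp (Primrec.snd.comp (Primrec.snd.comp Primrec.fst)) (Primrec.const []))
  have h2 : Primrec fun y : (ℕ × ℕ × RawCode M) × Certificate M => flattenCodes y.1.1 y.2.1 :=
    primrec_flattenCodes.comp (Primrec.fst.comp Primrec.fst) (Primrec.fst.comp Primrec.snd)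
  have h3 : Primrec fun y : (ℕ × ℕ × RawCode M) × Certificate M => y.2.2.2.2 :=
    Primrec.snd.comp (Primrec.snd.comp (Primrec.snd.comp Primrec.snd))
  have h4 : PrimrecPred fun y : (ℕ × ℕ × RawCode M) × Certificate M => y.2.1.length = y.1.2.1 :=
    Primrec.eq.comp (Primrec.list_length.comp (Primrec.fst.comp Primrec.snd))
      (Primrec.fst.comp (Primrec.snd.comp Primrec.fst))
  have h5 : PrimrecPred fun y : (ℕ × ℕ × RawCode M) × Certificate M =>
      ∀ e ∈ y.2.1, IsSequentialCode e :=
    .ball (Primrec.fst.comp Primrec.snd) (primrecPred_isSequentialCode.comp Primrec.snd)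
  have h6 := (primrecPred_isSimulationCode happ).comp (Primrec.pair (Primrec.pair h1 h2)
    (Primrec.pair (Primrec.fst.comp (Primrec.snd.comp Primrec.snd)) h3))
  have h7 := (primrecPred_isSimulationCode happ).comp (Primrec.pair (Primrec.pair h2 h1)
    (Primrec.pair (Primrec.fst.comp (Primrec.snd.comp (Primrec.snd.comp Primrec.snd))) h3))
  exact h4.and (h5.and (h6.and h7))

/-- The words that represent the neutral element if and only if the equations of a certificate
hold. -/
def Certificate.words (t : Certificate (GenWord r)) : List (GenWord r) :=
  t.2.2.2.map fun e => FreeGroup.invRev e.1 ++ e.2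

theorem Certificate.primrec_words : Primrec (Certificate.words (r := r)) := by
  have hinv : Primrec (FreeGroup.invRev (α := Fin r)) := by
    refine (Primrec.list_reverse.comp (Primrec.list_map Primrec.id
      (Primrec.pair (Primrec.fst.comp Primrec.snd)
        (Primrec.not.comp (Primrec.snd.comp Primrec.snd))).to₂)).of_eq fun w => rfl
  exact Primrec.list_map (Primrec.snd.comp (Primrec.snd.comp Primrec.snd))
    (Primrec.list_append.comp (hinv.comp (Primrec.fst.comp Primrec.snd))
      (Primrec.snd.comp Primrec.snd)).to₂

variable {G : Type*} [Group G] {s : Fin r → G}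

theorem Certificate.forall_words_iff (t : Certificate (GenWord r)) :
    (∀ w ∈ t.words, evalGenWord s w = 1) ↔
      ∀ e ∈ t.2.2.2, evalGenWord s e.1 = evalGenWord s e.2 := by
  simp only [Certificate.words, List.mem_map, forall_exists_index, and_imp,
    forall_apply_eq_imp_iff₂, evalGenWord_append, evalGenWord_invRev, inv_mul_eq_one]

theorem IsSimulationCode.mono {F E : FlatCode (GenWord r)}
    {B : List ((ℕ × ℕ) × List ((ℕ × ℕ) × GenWord r))} {T T' : List (GenWord r × GenWord r)}
    (h : IsSimulationCode F E B T) (hT : T ⊆ T') : IsSimulationCode F E B T' := by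
  obtain ⟨h1, h2, h3⟩ := h
  refine ⟨fun x hx => ?_, fun b hb t ht htb => ?_, fun b hb x hx hxb => ?_⟩
  · obtain ⟨b, hb, e1, h⟩ := h1 x hx
    refine ⟨b, hb, e1, fun y hy => ?_⟩
    obtain ⟨z, hz, e2, e, he, e3⟩ := h y hy
    exact ⟨z, hz, e2, e, hT he, e3⟩
  · obtain ⟨b', hb', e1, h⟩ := h2 b hb t ht htb
    refine ⟨b', hb', e1, fun y' hy' => ?_⟩
    obtain ⟨y, hy, t', ht', e2, e3, e4, e, he, e5⟩ := h y' hy'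
    exact ⟨y, hy, t', ht', e2, e3, e4, e, hT he, e5⟩
  · obtain ⟨y, hy, z, hz, e1, e, he, e2⟩ := h3 b hb x hx hxb
    exact ⟨y, hy, z, hz, e1, e, hT he, e2⟩

/-- A certificate whose equations hold is correct. -/
theorem IsCertificate.correct {m k : ℕ} {c : AutomatonCode r} {t : Certificate (GenWord r)}
    (h : IsCertificate (m, k, c) t) (ht : ∀ w ∈ t.words, evalGenWord s w = 1) :
    t.1.length = k ∧ (∀ i : Fin t.1.length, (AutomatonCode.toAutomaton s m (t.1.get i)).IsSequential) ∧
      (WeightedAutomaton.union fun i : Fin t.1.length => AutomatonCode.toAutomaton s m (t.1.get i)).rel =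
        (c.toAutomaton s m).rel := by
  rw [Certificate.forall_words_iff] at ht
  obtain ⟨h1, h2, h3, h4⟩ := h
  have hc := describes_toAutomaton s m c
  have hu : Describes s (flattenCodes m t.1) (WeightedAutomaton.union fun i : Fin t.1.length =>
      AutomatonCode.toAutomaton s m (t.1.get i)) fun p => ((p.1 : ℕ), (p.2 : ℕ)) :=
    describes_union rfl fun i => ⟨t.1.get i, _, _, _, by simp, rfl, rfl⟩
  exact ⟨h1, fun i => (h2 _ (List.get_mem _ _)).isSequential,
    ((h4.isSimulation hu hc ht).rel_subset).antisymm ((h3.isSimulation hc hu ht).rel_subset)⟩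

/-- For automata with the branching twinning property, there is a certificate whose equations
hold. -/
theorem exists_isCertificate (hs : Subgroup.closure (Set.range s) = ⊤) {m k : ℕ}
    {c : AutomatonCode r} (hk : 1 ≤ k) (hc : (c.toAutomaton s m).BTP k) :
    ∃ t, IsCertificate (m, k, c) t ∧ ∀ w ∈ t.words, evalGenWord s w = 1 := by
  obtain ⟨n, V, hV, h1, h2⟩ := hc.exists_sequential hs (Set.finite_range s) hk
  choose l l' l'' hl hlV using fun i => exists_isSequentialCode hs (hV i)
  set d : List (AutomatonCode r) := List.ofFn fun i => (n, l i, l' i, l'' i) with hd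
  have hdc := describes_toAutomaton s m c
  have hdu : Describes s (flattenCodes m d) (WeightedAutomaton.union V)
      fun p => ((p.1 : ℕ), (p.2 : ℕ)) := by
    refine describes_union (n := fun _ => n) (by simp [hd]) fun i =>
      ⟨_, l i, l' i, l'' i, ?_, rfl, hlV i⟩
    simp [hd]
  obtain ⟨B₁, T₁, hT₁, hB₁⟩ := exists_isSimulationCode hs hdc hdu h1
  obtain ⟨B₂, T₂, hT₂, hB₂⟩ := exists_isSimulationCode hs hdu hdc h2
  refine ⟨(d, B₁, B₂, T₁ ++ T₂), ⟨by simp [hd], ?_, hB₁.mono (by simp), hB₂.mono (by simp)⟩, ?_⟩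
  · intro e he
    obtain ⟨i, rfl⟩ := (List.mem_ofFn' _ _).1 he
    exact hl i
  · rw [Certificate.forall_words_iff]
    intro e he
    rcases List.mem_append.1 he with he | he
    · exact hT₁ e he
    · exact hT₂ e he

end Algorithm

theorem theorem1 {G : Type*} [Group G] (hG : IsInfinitary G) {r : ℕ} (s : Fin r → G)
    (hs : Subgroup.closure (Set.range s) = ⊤) :
    -- the three conditions are equivalent
    (∀ (A : Type*) [Finite A] (Q : Type*) [Finite Q] (W : WeightedAutomaton A Q G) (k : ℕ),
      W.IsTrim → 1 ≤ k →
        List.TFAE [LipschitzOfOrder (Set.range s) k W.rel, W.BTP k, IsKSequential k W.rel]) ∧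
    -- one algorithm (with the word problem of `G` as an oracle) computes, from the size `m` of
    -- the alphabet, the number `k` and an automaton satisfying the equivalent conditions,
    -- `k` sequential automata whose union computes the same relation
    (∃ f : ℕ × ℕ × AutomatonCode r →. List (AutomatonCode r),
      RecursiveIn {wordProblem s} f ∧
      ∀ (m k : ℕ) (c : AutomatonCode r), 1 ≤ k →
        (c.toAutomaton s m).IsTrim → (c.toAutomaton s m).BTP k →
        ∃ d ∈ f (m, k, c), d.length = k ∧
          (∀ i : Fin d.length, ((d.get i).toAutomaton s m).IsSequential) ∧
          (WeightedAutomaton.union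
            fun i : Fin d.length => (d.get i).toAutomaton s m).rel =
            (c.toAutomaton s m).rel) := by
  refine ⟨fun A _ Q _ W k hW hk => W.tfae hG hs (Set.finite_range s) hW hk, ?_⟩
  obtain ⟨f, hf, hfs⟩ := exists_recursiveIn_search s (primrecRel_isCertificate (M := GenWord r) Primrec.list_append)
    Certificate.primrec_words Primrec.fst
  refine ⟨f, hf, fun m k c hk _ hc => ?_⟩
  obtain ⟨t, ⟨ht, hw⟩, hmem⟩ := hfs (m, k, c) (exists_isCertificate hs hk hc)
  exact ⟨t.1, hmem, ht.correct hw⟩
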